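/- Let $p$ be a prime, $l\ge 1$, $q=p^l$, $D=p^{2l}=q^2$ and $\omega=e^{2\pi i/D}$. **Parafermions.** On $(\mathbb C^D)^{\otimes n}$ let $X_k|x\rangle=|x+e_k\rangle$ and $Z_k|x\rangle=\omega^{x_k}|x\rangle$. The $2n$ parafermion modes are $\gamma_{2j-1}=\big(\prod_{k<j}X_k\big)Z_j$ and $\gamma_{2j}=\omega^{(D-1)/2}\big(\prod_{k<j}X_k\big)Z_jX_j$, and $\mathrm{PF}(D,2n)$ is the group that they generate. The parity (charge) of $\omega^\lambda\gamma_1^{\alpha_1}\cdots\gamma_{2n}^{\alpha_{2n}}$ is $\sum_i\alpha_i \bmod D$; the operator preserves parity if this is $0$ and violates it otherwise. A *stabilizer group* is an abelian subgroup $\mathcal S$ of $\mathrm{PF}(D,2n)$ that consists of parity-preserving operators and contains no scalar $\omega^j\ne 1$. Its code space is the space of vectors fixed by $\mathcal S$. Its logical operators are the elements of its centralizer in $\mathrm{PF}(D,2n)$ that are not in $\mathcal S$. We say that $\mathcal S$ *encodes $k$ qudits with logical operators* $\mathcal X_i,\mathcal Z_i$ ($1\le i\le k$) if: the code space has dimension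 $D^k$; all $\mathcal X_i$ and $\mathcal Z_i$ are logical operators of $\mathcal S$; $\mathcal Z_i\mathcal X_i=\omega\mathcal X_i\mathcal Z_i$; all other pairs among the $\mathcal X_i,\mathcal Z_i$ commute; $\mathcal X_i^D=\mathcal Z_i^D=1$ after multiplying each of these operators by a suitable power of the phase $\omega^{(D-1)/2}$; and the centralizer of $\mathcal S$ is generated by $\mathcal S$ together with all $\mathcal X_i,\mathcal Z_i$. **Four modes per qudit.** Take $m\ge1$ sites with four modes each ($4m$ modes, $n=2m$). For the site with modes $\gamma_{1+4j},\dots,\gamma_{4+4j}$ put $$\tilde Z=\gamma_{1+4j}^{\,q-1}\gamma_{2+4j},\qquad \tilde X=\gamma_{1+4j}^{\,q-1}\gamma_{3+4j},\qquad \tilde Q=\gamma_{1+4j}^\dagger\,\gamma_{2+4j}^{\,q+1}\,(\gamma_{3+4j}^\dagger)^{q+1}\,\gamma_{4+4j}.$$ Then the group generated by the operators $\tilde Q$ of all sites is a stabilizer group that encodes $m$ qudits, with the operators $\tilde X,\tilde Z$ of the sites as logical operators. Moreover each $\tilde X$ and $\tilde Z$ has parity $q\not\equiv 0\pmod D$,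 and each $\tilde Q$ preserves parity. **Toric code.** Let $a,b\ge 1$, and consider the $a\times b$ square lattice on the torus, with vertices $(x,y)\in\mathbb Z_a\times\mathbb Z_b$. It has $2ab$ edges: $h(x,y)$ from $(x,y)$ to $(x+1,y)$ and $u(x,y)$ from $(x,y)$ to $(x,y+1)$. Identify the edges, by an arbitrary numbering, with $m=2ab$ sites. Fix a sign $\varepsilon=\pm1$ and put $$A_{(x,y)}=\tilde X_{h(x,y)}\tilde X_{h(x-1,y)}^{-1}\tilde X_{u(x,y)}^{\varepsilon}\tilde X_{u(x,y-1)}^{-\varepsilon},\qquad B_{(x,y)}=\tilde Z_{h(x,y)}\tilde Z_{h(x,y+1)}^{-1}\tilde Z_{u(x+1,y)}^{\varepsilon}\tilde Z_{u(x,y)}^{-\varepsilon}.$$ Then: 1. All $A_s$ and $B_p$ commute with each other and preserve parity, and $\prod_sA_s=\prod_pB_p=1$. They generate a stabilizer group, of order $D^{2(ab-1)}$. 2. The group $\mathcal S$ generated by all $A_s$, all $B_p$ and the operators $\tilde Q$ of all sites has order $D^{2ab+2(ab-1)}$. For every column $x$ and row $y$ it is a stabilizer group that encodes $k=2$ qudits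 (so its code space has dimension $D^2$), with the loop operators $$\mathcal X_1=\prod_{y'}\tilde X_{h(x,y')},\quad \mathcal Z_1=\prod_{x'}\tilde Z_{h(x',y)},\qquad \mathcal X_2=\prod_{x'}\tilde X_{u(x',y)},\quad \mathcal Z_2=\prod_{y'}\tilde Z_{u(x,y')}$$ as logical operators. 3. The horizontal loops $\mathcal Z_1,\mathcal X_2$ have parity $a\,p^l \bmod D$ and preserve parity if and only if $p^l\mid a$. The vertical loops $\mathcal X_1,\mathcal Z_2$ have parity $b\,p^l \bmod D$ and preserve parity if and only if $p^l\mid b$. In particular, if $p^l\mid a$ and $p^l\nmid b$, then the horizontal loops preserve parity and the vertical loops violate it. -/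

import Mathlib

open scoped Matrix

namespace Parafermion

noncomputable section

/-! ### Operators on `n` qudits of dimension `D`

Basis kets are `x : Fin n → ZMod D`; operators are unitary matrices, so `W⁻¹` is the adjoint. -/

/-- The unitary operators on the Hilbert space `(ℂ^D)^{⊗ n}`. -/
abbrev Op (D n : ℕ) [NeZero D] : Type :=
  ↥(Matrix.unitaryGroup (Fin n → ZMod D) ℂ)

/-- A diagonal unitary operator, with phases `exp (i * t x)`. -/
def diagOp (D n : ℕ) [NeZero D] (t : (Fin n → ZMod D) → ℝ) : Op D n :=
  ⟨Matrix.diagonal fun x => Complex.exp (t x * Complex.I), by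
    rw [Matrix.mem_unitaryGroup_iff, Matrix.star_eq_conjTranspose, Matrix.diagonal_conjTranspose,
      Matrix.diagonal_mul_diagonal, ← Matrix.diagonal_one]
    congr 1
    funext x
    simp only [Pi.star_apply, RCLike.star_def]
    rw [← Complex.exp_conj, ← Complex.exp_add]
    simp⟩

/-- The scalar operator `ω`, where `ω = exp (2πi/D)`. -/
def omega (D n : ℕ) [NeZero D] : Op D n :=
  diagOp D n fun _ => 2 * Real.pi / D

/-- The scalar operator `ω^((D-1)/2) = exp (πi(D-1)/D)`. -/
def halfPhase (D n : ℕ) [NeZero D] : Op D n :=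
  diagOp D n fun _ => Real.pi * (D - 1) / D

/-- The clock operator `Z_k |x⟩ = ω^(x_k) |x⟩`. -/
def clockZ (D n : ℕ) [NeZero D] (k : Fin n) : Op D n :=
  diagOp D n fun x => 2 * Real.pi * ((x k).val : ℝ) / D

/-- The shift operator `X_k |x⟩ = |x + e_k⟩`, with addition modulo `D`. -/
def shiftX (D n : ℕ) [NeZero D] (k : Fin n) : Op D n :=
  ⟨Matrix.of fun y x => if y = x + Pi.single k 1 then 1 else 0, by
    rw [Matrix.mem_unitaryGroup_iff]
    ext y z
    rw [Matrix.mul_apply, Finset.sum_eq_single (y - Pi.single k 1)]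
    · by_cases h : y = z
      · subst h; simp [Matrix.star_apply]
      · have h' : z ≠ y := fun h' => h h'.symm
        simp [Matrix.star_apply, h, h']
    · intro x _ hx
      have : y ≠ x + Pi.single k 1 := by
        rintro rfl
        exact hx (by simp)
      simp [this]
    · simp⟩

/-! ### Parafermion modes and the group `PF(D, 2n)` -/

/-- The Jordan-Wigner string `∏_{k < j} X_k`. -/
def jwString (D n : ℕ) [NeZero D] (j : Fin n) : Op D n :=
  (((List.finRange n).filter fun k => k < j).map (shiftX D n)).prod

/-- The `2n` parafermion modes. They are numbered from `0`: for even index `2j` this is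
`(∏_{k<j} X_k) Z_j`, for odd index `2j+1` it is `ω^((D-1)/2) (∏_{k<j} X_k) Z_j X_j`. -/
def gamma (D n : ℕ) [NeZero D] (i : Fin (2 * n)) : Op D n :=
  let j : Fin n := ⟨i / 2, by omega⟩
  if (i : ℕ) % 2 = 0 then jwString D n j * clockZ D n j
  else halfPhase D n * jwString D n j * clockZ D n j * shiftX D n j

/-- The parafermion group `PF(D, 2n)`. -/
def PF (D n : ℕ) [NeZero D] : Subgroup (Op D n) :=
  Subgroup.closure (Set.range (gamma D n))

/-- The ordered monomial `γ^α = γ_1^{α_1} ⋯ γ_{2n}^{α_{2n}}`. -/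
def monomial (D n : ℕ) [NeZero D] (α : Fin (2 * n) → ZMod D) : Op D n :=
  (List.ofFn fun i => gamma D n i ^ (α i).val).prod

/-- `W` is of the form `ω^c γ^α` with parity (charge) `∑ i, α i = t` modulo `D`. -/
def HasParity {D n : ℕ} [NeZero D] (W : Op D n) (t : ZMod D) : Prop :=
  ∃ (c : ℕ) (α : Fin (2 * n) → ZMod D), W = omega D n ^ c * monomial D n α ∧ ∑ i, α i = t

/-- Parity preservation: the charge vanishes modulo `D`. -/
def PreservesParity {D n : ℕ} [NeZero D] (W : Op D n) : Prop :=
  HasParity W 0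

/-! ### Parafermion stabilizer codes -/

/-- A parafermion stabilizer group: an abelian group of parity-preserving elements of
`PF(D, 2n)` that contains no scalar `ω^j ≠ 1`. -/
structure IsStabilizer {D n : ℕ} [NeZero D] (S : Subgroup (Op D n)) : Prop where
  le_PF : S ≤ PF D n
  parity : ∀ W ∈ S, PreservesParity W
  abelian : ∀ U ∈ S, ∀ V ∈ S, Commute U V
  no_scalar : ∀ j : ℕ, omega D n ^ j ∈ S → omega D n ^ j = 1

/-- The centralizer of `S` in `PF(D, 2n)`. -/
def centralizerPF {D n : ℕ} [NeZero D] (S : Subgroup (Op D n)) : Subgroup (Op D n) :=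
  PF D n ⊓ Subgroup.centralizer (S : Set (Op D n))

/-- The logical operators of `S`: elements of its centralizer that are not in `S`. -/
def logicalOperators {D n : ℕ} [NeZero D] (S : Subgroup (Op D n)) : Set (Op D n) :=
  (centralizerPF S : Set (Op D n)) \ S

/-- The code space: the vectors fixed by every element of `S`. -/
def codeSpace {D n : ℕ} [NeZero D] (S : Subgroup (Op D n)) :
    Submodule ℂ ((Fin n → ZMod D) → ℂ) where
  carrier := {ψ | ∀ W ∈ S, (W : Matrix (Fin n → ZMod D) (Fin n → ZMod D) ℂ) *ᵥ ψ = ψ}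
  zero_mem' := fun W _ => Matrix.mulVec_zero _
  add_mem' := fun {φ ψ} hφ hψ W hW => by rw [Matrix.mulVec_add, hφ W hW, hψ W hW]
  smul_mem' := fun c ψ hψ W hW => by rw [Matrix.mulVec_smul, hψ W hW]

/-- `S` is a parafermion stabilizer code that encodes `k` qudits of dimension `D`, with logical
qudit operators `X i`, `Z i`: these are logical operators of `S`, obey the Weyl relations of `k`
qudits (the `D`-th powers are `1` after the usual adjustment of the operators by a phase), and
generate the centralizer of `S` together with `S`; the code space has dimension `D ^ k`. -/
structure EncodesQudits {D n : ℕ} [NeZero D] (S : Subgroup (Op D n)) (k : ℕ)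
    (X Z : Fin k → Op D n) : Prop where
  stabilizer : IsStabilizer S
  dim_codeSpace : Module.finrank ℂ (codeSpace S) = D ^ k
  X_logical : ∀ i, X i ∈ logicalOperators S
  Z_logical : ∀ i, Z i ∈ logicalOperators S
  weyl : ∀ i, Z i * X i = omega D n * (X i * Z i)
  X_pow : ∀ i, ∃ t : ℕ, (halfPhase D n ^ t * X i) ^ D = 1
  Z_pow : ∀ i, ∃ t : ℕ, (halfPhase D n ^ t * Z i) ^ D = 1
  XX_comm : ∀ i j, Commute (X i) (X j)
  ZZ_comm : ∀ i j, Commute (Z i) (Z j)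
  ZX_comm : ∀ i j, i ≠ j → Commute (Z i) (X j)
  centralizer_eq :
    centralizerPF S = Subgroup.closure ((S : Set (Op D n)) ∪ Set.range X ∪ Set.range Z)

/-! ### Four modes for each qudit

There are `m` qudits (sites), hence `4m = 2(2m)` modes. -/

/-- The modes of site `j`: `mode j r` is the mode with (zero-based) number `4j + r`. -/
def mode {m : ℕ} (j : Fin m) (r : Fin 4) : Fin (2 * (2 * m)) :=
  ⟨4 * j + r, by omega⟩

/-- `Z̃ = γ₁^(q-1) γ₂` on the four modes of site `j`. -/
def siteZ (D q : ℕ) [NeZero D] {m : ℕ} (j : Fin m) : Op D (2 * m) :=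
  gamma D (2 * m) (mode j 0) ^ (q - 1) * gamma D (2 * m) (mode j 1)

/-- `X̃ = γ₁^(q-1) γ₃` on the four modes of site `j`. -/
def siteX (D q : ℕ) [NeZero D] {m : ℕ} (j : Fin m) : Op D (2 * m) :=
  gamma D (2 * m) (mode j 0) ^ (q - 1) * gamma D (2 * m) (mode j 2)

/-- `Q̃ = γ₁† γ₂^(q+1) (γ₃†)^(q+1) γ₄` on the four modes of site `j`. -/
def siteQ (D q : ℕ) [NeZero D] {m : ℕ} (j : Fin m) : Op D (2 * m) :=
  (gamma D (2 * m) (mode j 0))⁻¹ * gamma D (2 * m) (mode j 1) ^ (q + 1) *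
    (gamma D (2 * m) (mode j 2))⁻¹ ^ (q + 1) * gamma D (2 * m) (mode j 3)

/-! ### The `a × b` lattice on the torus -/

/-- The edges of the `a × b` square lattice on the torus; the qudits sit on the edges.
`horizontal x y` joins `(x, y)` to `(x+1, y)` and `vertical x y` joins `(x, y)` to `(x, y+1)`. -/
inductive Edge (a b : ℕ) : Type
  | horizontal (x : ZMod a) (y : ZMod b)
  | vertical (x : ZMod a) (y : ZMod b)

/-- Numberings of the `2ab` edges by `0, …, 2ab - 1`. -/
abbrev Numbering (a b : ℕ) : Type := Edge a b ≃ Fin (2 * (a * b))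

section Torus

variable (D q : ℕ) [NeZero D] {a b : ℕ} (e : Numbering a b)

/-- The star operator at the vertex `(x, y)`. Opposite edges enter with opposite signs; `ε` is the
sign of the upper edge relative to that of the right edge. -/
def star (ε : ℤˣ) (v : ZMod a × ZMod b) : Op D (2 * (2 * (a * b))) :=
  siteX D q (e (.horizontal v.1 v.2)) * (siteX D q (e (.horizontal (v.1 - 1) v.2)))⁻¹ *
    siteX D q (e (.vertical v.1 v.2)) ^ (ε : ℤ) *
    siteX D q (e (.vertical v.1 (v.2 - 1))) ^ (-(ε : ℤ))

/-- The plaquette operator of the face with lower left corner `(x, y)`. Opposite edges enter with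
opposite signs; `ε` is the sign of the right edge relative to that of the lower edge. -/
def plaquette (ε : ℤˣ) (v : ZMod a × ZMod b) : Op D (2 * (2 * (a * b))) :=
  siteZ D q (e (.horizontal v.1 v.2)) * (siteZ D q (e (.horizontal v.1 (v.2 + 1))))⁻¹ *
    siteZ D q (e (.vertical (v.1 + 1) v.2)) ^ (ε : ℤ) *
    siteZ D q (e (.vertical v.1 v.2)) ^ (-(ε : ℤ))

/-- The group generated by all star and plaquette operators. -/
def starPlaquetteGroup (ε : ℤˣ) : Subgroup (Op D (2 * (2 * (a * b)))) :=
  Subgroup.closure (Set.range (star D q e ε) ∪ Set.range (plaquette D q e ε))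

/-- The stabilizer group of the parafermion toric code: it is generated by all star and plaquette
operators and the one-qudit stabilizers `Q̃` of all sites. -/
def toricGroup (ε : ℤˣ) : Subgroup (Op D (2 * (2 * (a * b)))) :=
  starPlaquetteGroup D q e ε ⊔ Subgroup.closure (Set.range (siteQ D q))

/-- `Z̃` along the horizontal loop of lattice edges in row `y`. -/
def horizontalZ (y : ZMod b) : Op D (2 * (2 * (a * b))) :=
  (List.ofFn fun i : Fin a => siteZ D q (e (.horizontal ((i : ℕ) : ZMod a) y))).prod

/-- `Z̃` along the vertical loop of lattice edges in column `x`. -/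
def verticalZ (x : ZMod a) : Op D (2 * (2 * (a * b))) :=
  (List.ofFn fun i : Fin b => siteZ D q (e (.vertical x ((i : ℕ) : ZMod b)))).prod

/-- `X̃` along the horizontal loop of the dual lattice that crosses the vertical edges with lower
ends in row `y`. -/
def horizontalX (y : ZMod b) : Op D (2 * (2 * (a * b))) :=
  (List.ofFn fun i : Fin a => siteX D q (e (.vertical ((i : ℕ) : ZMod a) y))).prod

/-- `X̃` along the vertical loop of the dual lattice that crosses the horizontal edges with left
ends in column `x`. -/
def verticalX (x : ZMod a) : Op D (2 * (2 * (a * b))) :=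
  (List.ofFn fun i : Fin b => siteX D q (e (.horizontal x ((i : ℕ) : ZMod b)))).prod

end Torus

end

end Parafermion

/-! All operators in play commute up to a power of `ω`, so the proof tracks exponents in `ZMod D`:
`WeylComm ω U V t` is additive in `U` and in `V`, and `t` is unique. For modes the exponent is `1`
whenever `i < j` (`weylComm_gamma`). The charge is itself such an exponent: `shift 1`, the product
of all `X_k`, picks up one `ω` from each mode, so on `PF` the parity is the exponent with `shift 1`
(`HasParity.weylComm`, `hasParity_of_mem`).

The modes of two different sites all commute with one common exponent `t = ±1`. Operators of charges
`c`, `c'` at different sites therefore commute with exponent `t c c'`. The charges of `X̃`, `Z̃` are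
`q` with `q ^ 2 = 0` modulo `D`, and that of `Q̃` is `0`; hence operators at different sites commute
although single modes do not. Within a site a finite table of exponents gives `Z̃X̃ = ωX̃Z̃`, shows
that `Q̃` commutes with both, and that `γ₁` has exponent `1` with `Q̃`. Since `γ₁`, `X̃`, `Z̃`, `Q̃`
generate the four modes, this is all the information needed; it is recorded in `SiteSystem`.

In a `SiteSystem`, orthogonal subgroups `LX`, `LZ` of `ι → ZMod D` and any `LQ` give an abelian
group of words `X^x Z^z Q^w`. A word determines its exponents, which gives the order of the group. A
word other than `1` fails to commute with some operator, so it is no scalar and has trace zero; the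
trace of the averaging projection then yields the dimension of the code space
(`finrank_codeSpace_mul_card`). For the centralizer, an element of `Γ` is divided by words in `X`,
`Z` and `Q` until it commutes with all generators; what remains is a power of `ω`
(`mem_zpowers_of_commute`).

Thus encoding becomes linear algebra over `ZMod D` (`encodesQudits_wordGroup`): the orthogonal
complement of each of `LX`, `LZ` must be the other one plus the span of dual logical vectors. For
separate sites both are zero. For the toric code they are the exponents of stars and plaquettes, and
the complements are the first (co)homology of the discrete torus. As `ZMod D` is not a field,
dimension counting is replaced by an explicit potential, built from partial sums around cycles
(`exists_potential`). Orders follow because only constant functions give trivial products of stars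
or plaquettes. A loop through `k` sites has charge `k q`, which vanishes modulo `q ^ 2` exactly when
`q ∣ k`. -/

namespace WeylSystem

set_option linter.unusedSectionVars false

variable {G : Type*} [Group G] {D : ℕ} [NeZero D]

/-! ### Central phases and commutation up to a phase -/

/-- `ω` is a central element of order `D`. -/
structure IsPhase (D : ℕ) (ω : G) : Prop where
  order : orderOf ω = D
  central : ∀ g : G, Commute ω g

/-- The power `ω ^ t` for an exponent `t` modulo `D`. -/
def phase (ω : G) (t : ZMod D) : G := ω ^ t.val

/-- `U` and `V` commute up to the phase `ω ^ t`. -/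
def WeylComm (ω U V : G) (t : ZMod D) : Prop := U * V = phase ω t * (V * U)

namespace IsPhase

variable {ω : G} (hω : IsPhase D ω)
include hω

theorem phase_natCast (k : ℕ) : phase ω (k : ZMod D) = ω ^ k := by
  rw [phase, ZMod.val_natCast]
  conv_lhs => rw [← hω.order, pow_mod_orderOf]

theorem phase_add (s t : ZMod D) : phase ω (s + t) = phase ω s * phase ω t := by
  rw [← ZMod.natCast_zmod_val s, ← ZMod.natCast_zmod_val t, ← Nat.cast_add, hω.phase_natCast,
    hω.phase_natCast, hω.phase_natCast, pow_add]

omit hω in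
theorem phase_zero : phase ω (0 : ZMod D) = 1 := by simp [phase]

theorem phase_neg (t : ZMod D) : phase ω (-t) = (phase ω t)⁻¹ := by
  rw [eq_inv_iff_mul_eq_one, ← hω.phase_add, neg_add_cancel, phase_zero]

theorem phase_nsmul (k : ℕ) (t : ZMod D) : phase ω ((k : ZMod D) * t) = phase ω t ^ k := by
  rw [← ZMod.natCast_zmod_val t, ← Nat.cast_mul, hω.phase_natCast, hω.phase_natCast, mul_comm,
    pow_mul]

theorem phase_eq_one_iff {t : ZMod D} : phase ω t = 1 ↔ t = 0 := by
  refine ⟨fun h => ?_, fun h => by rw [h, phase_zero]⟩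
  have h1 := orderOf_dvd_of_pow_eq_one h
  rw [hω.order] at h1
  rw [← ZMod.natCast_zmod_val t]
  exact (ZMod.natCast_eq_zero_iff _ _).2 h1

theorem phase_injective : Function.Injective (phase ω : ZMod D → G) := by
  intro s t h
  rw [← sub_eq_zero, ← hω.phase_eq_one_iff, sub_eq_add_neg, hω.phase_add, hω.phase_neg, h,
    mul_inv_cancel]

theorem phase_comm (t : ZMod D) (g : G) : Commute (phase ω t) g :=
  (hω.central g).pow_left _

theorem mem_zpowers_iff {g : G} : g ∈ Subgroup.zpowers ω ↔ ∃ t : ZMod D, g = phase ω t := by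
  constructor
  · intro h
    have hf : IsOfFinOrder ω := by
      rw [← orderOf_pos_iff, hω.order]; exact Nat.pos_of_ne_zero (NeZero.ne D)
    obtain ⟨k, rfl⟩ := (hf.mem_powers_iff_mem_zpowers).2 h
    exact ⟨k, (hω.phase_natCast k).symm⟩
  · rintro ⟨t, rfl⟩
    exact pow_mem (Subgroup.mem_zpowers ω) _

theorem weylComm_zero_iff {U V : G} : WeylComm ω U V (0 : ZMod D) ↔ Commute U V := by
  rw [WeylComm, phase_zero, one_mul]; rfl

theorem weylComm_unique {U V : G} {s t : ZMod D} (hs : WeylComm ω U V s)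
    (ht : WeylComm ω U V t) : s = t :=
  hω.phase_injective (mul_right_cancel (hs.symm.trans ht))

theorem weylComm_commute {U V : G} {t : ZMod D} (ht : WeylComm ω U V t) :
    Commute U V ↔ t = 0 := by
  rw [← hω.weylComm_zero_iff]
  exact ⟨fun h => hω.weylComm_unique ht h, fun h => h ▸ ht⟩

theorem weylComm_symm {U V : G} {t : ZMod D} (h : WeylComm ω U V t) : WeylComm ω V U (-t) := by
  rw [WeylComm, h, hω.phase_neg, inv_mul_cancel_left]

theorem weylComm_mul_left {U V W : G} {s t : ZMod D} (hU : WeylComm ω U W s)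
    (hV : WeylComm ω V W t) : WeylComm ω (U * V) W (s + t) := by
  have h1 := (hω.phase_comm t U).eq
  unfold WeylComm at *
  rw [mul_assoc, hV, ← mul_assoc U, ← h1, mul_assoc, ← mul_assoc U, hU, add_comm s, hω.phase_add]
  group

theorem weylComm_mul_right {U V W : G} {s t : ZMod D} (hV : WeylComm ω U V s)
    (hW : WeylComm ω U W t) : WeylComm ω U (V * W) (s + t) := by
  have := hω.weylComm_symm (hω.weylComm_mul_left (hω.weylComm_symm hV) (hω.weylComm_symm hW))
  rwa [neg_add, neg_neg, neg_neg] at this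

theorem weylComm_of_commute {U V : G} (h : Commute U V) : WeylComm ω U V (0 : ZMod D) :=
  hω.weylComm_zero_iff.2 h

theorem weylComm_inv_left {U V : G} {t : ZMod D} (h : WeylComm ω U V t) :
    WeylComm ω U⁻¹ V (-t) := by
  have h1 := (hω.phase_comm t U⁻¹).eq
  rw [WeylComm, hω.phase_neg, eq_inv_mul_iff_mul_eq, ← mul_assoc, h1, mul_assoc,
    inv_mul_eq_iff_eq_mul, ← mul_assoc, h, mul_assoc (phase ω t), mul_assoc V, mul_inv_cancel,
    mul_one]

theorem weylComm_inv_right {U V : G} {t : ZMod D} (h : WeylComm ω U V t) :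
    WeylComm ω U V⁻¹ (-t) := by
  have := hω.weylComm_symm (hω.weylComm_inv_left (hω.weylComm_symm h))
  rwa [neg_neg] at this

theorem weylComm_pow_left {U V : G} {t : ZMod D} (h : WeylComm ω U V t) (k : ℕ) :
    WeylComm ω (U ^ k) V ((k : ZMod D) * t) := by
  induction k with
  | zero => simpa using hω.weylComm_of_commute (Commute.one_left V)
  | succ k ih =>
    have := hω.weylComm_mul_left ih h
    rwa [← pow_succ, ← add_one_mul, ← Nat.cast_succ] at this

theorem weylComm_pow_right {U V : G} {t : ZMod D} (h : WeylComm ω U V t) (k : ℕ) :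
    WeylComm ω U (V ^ k) ((k : ZMod D) * t) := by
  have := hω.weylComm_symm (hω.weylComm_pow_left (hω.weylComm_symm h) k)
  rwa [mul_neg, neg_neg] at this

theorem weylComm_zpow_left {U V : G} {t : ZMod D} (h : WeylComm ω U V t) (k : ℤ) :
    WeylComm ω (U ^ k) V ((k : ZMod D) * t) := by
  obtain ⟨n, rfl | rfl⟩ := k.eq_nat_or_neg
  · simpa using hω.weylComm_pow_left h n
  · simpa using hω.weylComm_inv_left (hω.weylComm_pow_left h n)

theorem weylComm_zpow_right {U V : G} {t : ZMod D} (h : WeylComm ω U V t) (k : ℤ) :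
    WeylComm ω U (V ^ k) ((k : ZMod D) * t) := by
  have := hω.weylComm_symm (hω.weylComm_zpow_left (hω.weylComm_symm h) k)
  rwa [mul_neg, neg_neg] at this

theorem weylComm_list_prod {κ : Type*} (l : List κ) (g : κ → G) (s : κ → ZMod D) {V : G}
    (h : ∀ k, WeylComm ω (g k) V (s k)) : WeylComm ω (l.map g).prod V (l.map s).sum := by
  induction l with
  | nil => simpa using hω.weylComm_of_commute (Commute.one_left V)
  | cons k l ih => simpa using hω.weylComm_mul_left (h k) ih

theorem conj_eq_of_weylComm {U V : G} {t : ZMod D} (h : WeylComm ω U V t) :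
    V⁻¹ * U * V = phase ω t * U := by
  rw [mul_assoc, h, ← mul_assoc, ← (hω.phase_comm t V⁻¹).eq, mul_assoc, inv_mul_cancel_left]

/-- The power of a product of two operators that commute up to a phase. -/
theorem mul_pow_of_weylComm {U V : G} {t : ZMod D} (h : WeylComm ω U V t) (k : ℕ) :
    (U * V) ^ k = phase ω (-(t * (k.choose 2 : ZMod D))) * (U ^ k * V ^ k) := by
  induction k with
  | zero => simp [phase_zero]
  | succ k ih =>
    have h1 : V ^ k * U = phase ω ((k : ZMod D) * -t) * (U * V ^ k) :=
      hω.weylComm_pow_left (hω.weylComm_symm h) k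
    have h2 := (hω.phase_comm ((k : ZMod D) * -t) (U ^ k)).eq
    rw [pow_succ, ih, Nat.choose_succ_succ' k 1, Nat.choose_one_right]
    calc _ = phase ω (-(t * (k.choose 2 : ZMod D))) * (U ^ k * (V ^ k * U) * V) := by group
      _ = phase ω (-(t * (k.choose 2 : ZMod D))) * phase ω ((k : ZMod D) * -t) * (U ^ (k + 1) * V ^ (k + 1)) := by
        rw [h1, ← mul_assoc (U ^ k), ← h2]; group
      _ = _ := by
        rw [← hω.phase_add]; congr 2; push_cast; ring

/-! ### Normal form of the elements of a group generated by operators commuting up to phases -/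

/-- The power of `g i` moves right past the earlier factors, at the cost of a phase each, and is
absorbed in its own slot; the phases are central and gather in front. `Nodup` ensures that there is
only one such slot. -/
theorem zpow_mul_list_prod {κ : Type*} [DecidableEq κ] (g : κ → G)
    (hg : ∀ i j, ∃ t : ZMod D, WeylComm ω (g i) (g j) t) (i : κ) (s : ℤ) :
    ∀ (l : List κ), l.Nodup → i ∈ l → ∀ a : κ → ℤ, ∃ t : ZMod D,
      g i ^ s * (l.map fun k => g k ^ a k).prod =
        phase ω t * (l.map fun k => g k ^ Function.update a i (s + a i) k).prod := by
  intro l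
  induction l with
  | nil => intro _ h; simp at h
  | cons j l ih =>
    intro hl hi a
    rw [List.nodup_cons] at hl
    by_cases hij : i = j
    · subst hij
      refine ⟨0, ?_⟩
      rw [phase_zero, one_mul, List.map_cons, List.map_cons, List.prod_cons, List.prod_cons,
        Function.update_self, zpow_add, mul_assoc]
      congr 3
      refine List.map_congr_left fun k hk => ?_
      rw [Function.update_of_ne]
      rintro rfl
      exact hl.1 hk
    · obtain ⟨t, ht⟩ := ih hl.2 ((List.mem_cons.1 hi).resolve_left hij) a
      obtain ⟨u, hu⟩ := hg i j
      have hu' : g i ^ s * g j ^ a j = _ :=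
        hω.weylComm_zpow_right (hω.weylComm_zpow_left hu s) (a j)
      refine ⟨a j * (s * u) + t, ?_⟩
      · rw [List.map_cons, List.map_cons, List.prod_cons, List.prod_cons,
          Function.update_of_ne (Ne.symm hij), ← mul_assoc, hu', mul_assoc, mul_assoc, ht,
          ← mul_assoc (g j ^ a j), ← (hω.phase_comm t (g j ^ a j)).eq, ← mul_assoc, ← mul_assoc,
          ← hω.phase_add, mul_assoc]

/-- Ordered monomials with a phase are stable under left multiplication by each `g i` and its
inverse, and left induction on the closure needs no more. The exponents stay integers because no
order of the `g i` is assumed. -/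
theorem exists_list_prod_of_mem_closure {κ : Type*} [DecidableEq κ] (g : κ → G)
    (hg : ∀ i j, ∃ t : ZMod D, WeylComm ω (g i) (g j) t) (l : List κ) (hl : l.Nodup)
    (hmem : ∀ k, k ∈ l) {W : G} (hW : W ∈ Subgroup.closure (Set.range g)) :
    ∃ (t : ZMod D) (a : κ → ℤ), W = phase ω t * (l.map fun k => g k ^ a k).prod := by
  have step : ∀ (i : κ) (s : ℤ) (W : G),
      (∃ (t : ZMod D) (a : κ → ℤ), W = phase ω t * (l.map fun k => g k ^ a k).prod) →
      ∃ (t : ZMod D) (a : κ → ℤ), g i ^ s * W = phase ω t * (l.map fun k => g k ^ a k).prod := by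
    rintro i s W ⟨t, a, rfl⟩
    obtain ⟨u, hu⟩ := hω.zpow_mul_list_prod g hg i s l hl (hmem i) a
    refine ⟨t + u, Function.update a i (s + a i), ?_⟩
    rw [← mul_assoc, ← (hω.phase_comm t (g i ^ s)).eq, mul_assoc, hu, ← mul_assoc,
      ← hω.phase_add]
  induction hW using Subgroup.closure_induction_left with
  | one => exact ⟨0, 0, by simp [phase_zero]⟩
  | mul_left x hx y _ ih =>
    obtain ⟨i, rfl⟩ := hx
    simpa using step i 1 y ih
  | inv_mul_cancel x hx y _ ih =>
    obtain ⟨i, rfl⟩ := hx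
    simpa using step i (-1) y ih

end IsPhase

/-! ### Products of powers of commuting operators of order dividing `D` -/

/-- Unit vectors generate `ι → ZMod D` as an additive group, and natural multiples suffice because
every residue has a natural representative. -/
theorem pi_zmod_induction {ι : Type*} [Fintype ι] [DecidableEq ι] {p : (ι → ZMod D) → Prop}
    (zero : p 0) (add : ∀ x y, p x → p y → p (x + y)) (single : ∀ i, p (Pi.single i 1))
    (x : ι → ZMod D) : p x := by
  have h1 : ∀ i (k : ℕ), p (k • Pi.single i 1) := by
    intro i k
    induction k with
    | zero => simpa using zero
    | succ k ih => rw [succ_nsmul]; exact add _ _ ih (single i)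
  have h2 : x = ∑ i, (x i).val • Pi.single i (1 : ZMod D) := by
    ext j
    simp only [Finset.sum_apply, Pi.smul_apply, Pi.single_apply, smul_ite, smul_zero,
      Finset.sum_ite_eq, Finset.mem_univ, if_true]
    rw [nsmul_eq_mul, mul_one, ZMod.natCast_zmod_val]
  rw [h2]
  exact Finset.sum_induction _ p add zero fun i _ => h1 i _

/-- Each `g i` defines a homomorphism from `ZMod D` because its `D`-th power is `1`; these have
commuting images and glue to one on the product. -/
theorem exists_piHom {ι : Type*} [Fintype ι] [DecidableEq ι] (g : ι → G)
    (hc : ∀ i j, Commute (g i) (g j)) (hD : ∀ i, g i ^ D = 1) :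
    ∃ Φ : Multiplicative (ι → ZMod D) →* G, ∀ i, Φ (.ofAdd (Pi.single i 1)) = g i := by
  have hpow : ∀ i (s t : ZMod D), g i ^ (s + t).val = g i ^ s.val * g i ^ t.val := by
    intro i s t
    rw [ZMod.val_add, ← pow_add, ← pow_mod_orderOf,
      Nat.mod_mod_of_dvd _ (orderOf_dvd_of_pow_eq_one (hD i)), pow_mod_orderOf]
  let φ : ∀ _ : ι, Multiplicative (ZMod D) →* G := fun i =>
    { toFun := fun t => g i ^ (Multiplicative.toAdd t).val
      map_one' := by simp
      map_mul' := fun s t => hpow i _ _ }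
  have hφ : Pairwise fun i j => ∀ x y, Commute (φ i x) (φ j y) :=
    fun i j _ x y => (hc i j).pow_pow _ _
  refine ⟨(MonoidHom.noncommPiCoprod φ hφ).comp
    { toFun := fun x i => Multiplicative.ofAdd (Multiplicative.toAdd x i)
      map_one' := rfl
      map_mul' := fun _ _ => rfl }, fun i => ?_⟩
  have h1 : (fun j => Multiplicative.ofAdd ((Pi.single i 1 : ι → ZMod D) j)) =
      Pi.mulSingle i (Multiplicative.ofAdd (1 : ZMod D)) := by
    ext j
    by_cases h : j = i
    · subst h; simp
    · simp [h]
  have h2 : φ i (Multiplicative.ofAdd 1) = g i := by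
    -- Going through the cast of `1` also covers `D = 1`, where the representative of `1` is `0`.
    have h4 : g i ^ ((1 : ℕ) : ZMod D).val = g i := by
      rw [ZMod.val_natCast, ← pow_mod_orderOf,
        Nat.mod_mod_of_dvd _ (orderOf_dvd_of_pow_eq_one (hD i)), pow_mod_orderOf, pow_one]
    simpa [φ] using h4
  refine Eq.trans ?_ h2
  rw [← MonoidHom.noncommPiCoprod_mulSingle (ϕ := φ) (hcomm := hφ) i (Multiplicative.ofAdd 1),
    ← h1]
  rfl

/-- For a commuting family `g` of elements with `D`-th power `1`, the homomorphism
`x ↦ ∏ i, g i ^ x i`. -/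
noncomputable def piHom {ι : Type*} [Fintype ι] [DecidableEq ι] (g : ι → G)
    (hc : ∀ i j, Commute (g i) (g j)) (hD : ∀ i, g i ^ D = 1) :
    Multiplicative (ι → ZMod D) →* G := (exists_piHom g hc hD).choose

theorem piHom_single {ι : Type*} [Fintype ι] [DecidableEq ι] (g : ι → G)
    (hc : ∀ i j, Commute (g i) (g j)) (hD : ∀ i, g i ^ D = 1) (i : ι) :
    piHom g hc hD (.ofAdd (Pi.single i 1)) = g i := (exists_piHom g hc hD).choose_spec i

/-- Both the operator and the exponent are additive in `x`, so unit vectors decide. -/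
theorem IsPhase.weylComm_hom {ω : G} (hω : IsPhase D ω) {ι : Type*} [Fintype ι] [DecidableEq ι]
    (Φ : Multiplicative (ι → ZMod D) →* G) {V : G} (s : ι → ZMod D)
    (h : ∀ i, WeylComm ω V (Φ (.ofAdd (Pi.single i 1))) (s i)) (x : ι → ZMod D) :
    WeylComm ω V (Φ (.ofAdd x)) (s ⬝ᵥ x) := by
  induction x using pi_zmod_induction with
  | zero => simpa using hω.weylComm_of_commute (Commute.one_right V)
  | add x y hx hy => simpa [dotProduct_add] using hω.weylComm_mul_right hx hy
  | single i => simpa using h i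

end WeylSystem

namespace Parafermion

open WeylSystem

set_option linter.unusedSectionVars false

variable {D n : ℕ} [NeZero D]

/-! ### Clock and shift operators -/

theorem coe_diagOp (t : (Fin n → ZMod D) → ℝ) :
    (diagOp D n t : Matrix (Fin n → ZMod D) (Fin n → ZMod D) ℂ) =
      Matrix.diagonal fun x => Complex.exp (t x * Complex.I) := rfl

theorem diagOp_mul (s t : (Fin n → ZMod D) → ℝ) :
    diagOp D n s * diagOp D n t = diagOp D n (s + t) := by
  apply Subtype.ext
  rw [Submonoid.coe_mul, coe_diagOp, coe_diagOp, coe_diagOp, Matrix.diagonal_mul_diagonal]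
  congr 1
  funext x
  rw [← Complex.exp_add, Pi.add_apply]
  push_cast
  ring_nf

theorem diagOp_zero : diagOp D n 0 = 1 := by
  apply Subtype.ext
  rw [coe_diagOp]
  simp

theorem diagOp_pow (t : (Fin n → ZMod D) → ℝ) (k : ℕ) :
    diagOp D n t ^ k = diagOp D n (k • t) := by
  induction k with
  | zero => rw [pow_zero, zero_smul, diagOp_zero]
  | succ k ih => rw [pow_succ, ih, diagOp_mul, succ_nsmul]

theorem diagOp_const_comm (c : ℝ) (U : Op D n) : Commute (diagOp D n fun _ => c) U := by
  apply Subtype.ext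
  rw [Submonoid.coe_mul, Submonoid.coe_mul, coe_diagOp]
  ext x y
  simp [mul_comm]

theorem exp_val_eq_stdAddChar (t : ZMod D) :
    Complex.exp ((2 * Real.pi * (t.val : ℝ) / D : ℝ) * Complex.I) = ZMod.stdAddChar t := by
  rw [ZMod.stdAddChar_apply, ZMod.toCircle_apply]
  congr 1
  push_cast
  ring

theorem coe_clockZ (k : Fin n) :
    (clockZ D n k : Matrix (Fin n → ZMod D) (Fin n → ZMod D) ℂ) =
      Matrix.diagonal fun x => ZMod.stdAddChar (x k) := by
  rw [clockZ, coe_diagOp]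
  congr 1
  funext x
  exact exp_val_eq_stdAddChar _

theorem coe_omega_pow (k : ℕ) :
    ((omega D n ^ k : Op D n) : Matrix (Fin n → ZMod D) (Fin n → ZMod D) ℂ) =
      Matrix.diagonal fun _ => ZMod.stdAddChar (k : ZMod D) := by
  rw [omega, diagOp_pow, coe_diagOp]
  congr 1
  funext x
  rw [← Int.cast_natCast k, ZMod.stdAddChar_coe]
  congr 1
  simp only [Pi.smul_apply, nsmul_eq_mul]
  push_cast
  ring

theorem omega_pow_eq_one_iff (k : ℕ) : omega D n ^ k = 1 ↔ D ∣ k := by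
  rw [← ZMod.natCast_eq_zero_iff]
  constructor
  · intro h
    have h1 := congrArg (fun U : Op D n => (U : Matrix (Fin n → ZMod D) (Fin n → ZMod D) ℂ) 0 0) h
    simp only [coe_omega_pow, Matrix.diagonal_apply_eq, Submonoid.coe_one,
      Matrix.one_apply_eq] at h1
    exact ZMod.injective_stdAddChar (h1.trans (AddChar.map_zero_eq_one _).symm)
  · intro h
    apply Subtype.ext
    rw [coe_omega_pow, h, AddChar.map_zero_eq_one]
    simp

theorem isPhase_omega : IsPhase D (omega D n) where
  order := Nat.dvd_antisymm (orderOf_dvd_of_pow_eq_one ((omega_pow_eq_one_iff D).2 dvd_rfl))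
    ((omega_pow_eq_one_iff _).1 (pow_orderOf_eq_one _))
  central := diagOp_const_comm _

theorem halfPhase_comm (U : Op D n) : Commute (halfPhase D n) U := diagOp_const_comm _ U

/-- `D (D - 1) / 2` is a binomial coefficient, the same one that appears when the `D`-th power of a
product is reordered (`mul_pow_of_weylComm`). The half phase exists for this cancellation. -/
theorem halfPhase_pow_dim :
    halfPhase D n ^ D = phase (omega D n) (D.choose 2 : ZMod D) := by
  rw [isPhase_omega.phase_natCast, halfPhase, omega, diagOp_pow, diagOp_pow]
  congr 1
  funext x
  have : (D : ℝ) ≠ 0 := Nat.cast_ne_zero.2 (NeZero.ne D)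
  simp only [Pi.smul_apply, nsmul_eq_mul, Nat.cast_choose_two]
  field_simp

theorem coe_phase (t : ZMod D) :
    ((phase (omega D n) t : Op D n) : Matrix (Fin n → ZMod D) (Fin n → ZMod D) ℂ) =
      ZMod.stdAddChar t • 1 := by
  rw [phase, coe_omega_pow, ZMod.natCast_zmod_val, Matrix.smul_one_eq_diagonal]

/-- The shift `|x⟩ ↦ |x + v⟩`. -/
noncomputable def shift (v : Fin n → ZMod D) : Op D n :=
  ⟨Matrix.of fun y x => if y = x + v then 1 else 0, by
    rw [Matrix.mem_unitaryGroup_iff]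
    ext y z
    rw [Matrix.mul_apply, Finset.sum_eq_single (y - v)]
    · by_cases h : y = z
      · subst h; simp [Matrix.star_apply]
      · have h' : z ≠ y := fun h' => h h'.symm
        simp [Matrix.star_apply, h, h']
    · intro x _ hx
      have : y ≠ x + v := by
        rintro rfl
        exact hx (by simp)
      simp [this]
    · simp⟩

theorem coe_shift_apply (v x y : Fin n → ZMod D) :
    (shift v : Matrix (Fin n → ZMod D) (Fin n → ZMod D) ℂ) y x = if y = x + v then 1 else 0 := rfl

theorem shiftX_eq (k : Fin n) : shiftX D n k = shift (Pi.single k 1) := rfl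

theorem shift_mul (u v : Fin n → ZMod D) : shift u * shift v = shift (u + v) := by
  apply Subtype.ext
  ext y x
  rw [Submonoid.coe_mul, Matrix.mul_apply, Finset.sum_eq_single (x + v)]
  · simp only [coe_shift_apply, if_true, mul_one]
    rw [add_assoc, add_comm v u]
  · intro z _ hz
    simp [coe_shift_apply, hz]
  · simp

theorem shift_zero : shift (0 : Fin n → ZMod D) = 1 := by
  apply Subtype.ext
  ext y x
  rw [coe_shift_apply, add_zero, Submonoid.coe_one, Matrix.one_apply]

theorem shift_pow (v : Fin n → ZMod D) (k : ℕ) : shift v ^ k = shift (k • v) := by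
  induction k with
  | zero => rw [pow_zero, zero_smul, shift_zero]
  | succ k ih => rw [pow_succ, ih, shift_mul, succ_nsmul]

theorem shift_pow_dim (v : Fin n → ZMod D) : shift v ^ D = 1 := by
  rw [shift_pow, ← shift_zero]
  congr 1
  ext k
  simp

theorem shift_comm (u v : Fin n → ZMod D) : Commute (shift u) (shift v) := by
  rw [Commute, SemiconjBy, shift_mul, shift_mul, add_comm]

theorem clockZ_comm (j k : Fin n) : Commute (clockZ D n j) (clockZ D n k) := by
  rw [Commute, SemiconjBy, clockZ, clockZ, diagOp_mul, diagOp_mul, add_comm]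

theorem clockZ_pow_dim (k : Fin n) : clockZ D n k ^ D = 1 := by
  apply Subtype.ext
  rw [SubmonoidClass.coe_pow, coe_clockZ, Matrix.diagonal_pow, Submonoid.coe_one,
    ← Matrix.diagonal_one]
  congr 1
  funext x
  rw [Pi.pow_apply, ← AddChar.map_nsmul_eq_pow]
  simp

/-- The one Weyl relation checked on matrix entries; the exponents between modes follow from it by
additivity. -/
theorem weylComm_clockZ_shift (k : Fin n) (v : Fin n → ZMod D) :
    WeylComm (omega D n) (clockZ D n k) (shift v) (v k) := by
  apply Subtype.ext
  simp only [Submonoid.coe_mul, coe_phase, coe_clockZ]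
  ext y x
  rw [Matrix.smul_mul, Matrix.one_mul, Matrix.diagonal_mul, Matrix.smul_apply,
    Matrix.mul_diagonal, coe_shift_apply]
  split_ifs with h
  · rw [h, Pi.add_apply, AddChar.map_add_eq_mul, smul_eq_mul]
    ring
  · simp

/-! ### The modes -/

theorem jwString_eq (j : Fin n) :
    jwString D n j = shift fun k => if k < j then 1 else 0 := by
  -- The claim is generalized to duplicate-free lists so that induction on the list applies.
  have h1 : ∀ l : List (Fin n), l.Nodup →
      (l.map (shiftX D n)).prod = shift fun k => if k ∈ l then 1 else 0 := by
    intro l hl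
    induction l with
    | nil => exact (shift_zero (D := D) (n := n)).symm.trans (by congr 1)
    | cons i l ih =>
      rw [List.nodup_cons] at hl
      rw [List.map_cons, List.prod_cons, ih hl.2, shiftX_eq, shift_mul]
      congr 1
      ext k
      by_cases h : k = i
      · subst h; simp [hl.1]
      · simp [h]
  rw [jwString, h1 _ ((List.nodup_finRange n).filter _)]
  simp

/-- The qudit of a mode. -/
def modeSite (i : Fin (2 * n)) : Fin n := ⟨i / 2, by omega⟩

/-- The shift vector of a mode. -/
def modeShift (D : ℕ) (i : Fin (2 * n)) : Fin n → ZMod D :=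
  fun k => if 2 * (k : ℕ) < i then 1 else 0

/-- A common shape for the even and the odd modes. Up to the central `c`, exponents depend only on
the clock's site and on the total shift. The condition `2 * k < i` in `modeShift` means `k < j` for
`i = 2j` and `k ≤ j` for `i = 2j + 1`. -/
theorem gamma_eq (i : Fin (2 * n)) :
    ∃ (c : Op D n) (u v : Fin n → ZMod D), (∀ U, Commute c U) ∧
      gamma D n i = c * shift u * clockZ D n (modeSite i) * shift v ∧ u + v = modeShift D i := by
  by_cases h : (i : ℕ) % 2 = 0
  · refine ⟨1, fun k => if k < modeSite i then 1 else 0, 0, Commute.one_left, ?_, ?_⟩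
    · rw [gamma, if_pos h, jwString_eq, shift_zero, one_mul, mul_one]; rfl
    · ext k
      simp only [modeShift, modeSite, Fin.lt_def, add_zero]
      congr 1
      simp only [eq_iff_iff]; omega
  · refine ⟨halfPhase D n, fun k => if k < modeSite i then 1 else 0, Pi.single (modeSite i) 1,
      halfPhase_comm, ?_, ?_⟩
    · rw [gamma, if_neg h, jwString_eq]; rfl
    · ext k
      simp only [modeShift, modeSite, Fin.lt_def, Pi.add_apply, Pi.single_apply, Fin.ext_iff]
      split_ifs <;> first | omega | simp

theorem weylComm_gamma_shift (i : Fin (2 * n)) (w : Fin n → ZMod D) :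
    WeylComm (omega D n) (gamma D n i) (shift w) (w (modeSite i)) := by
  obtain ⟨c, u, v, hc, h, -⟩ := gamma_eq (D := D) i
  have hω := isPhase_omega (D := D) (n := n)
  rw [h]
  have := hω.weylComm_mul_left (hω.weylComm_mul_left (hω.weylComm_mul_left
    (hω.weylComm_of_commute (hc (shift w))) (hω.weylComm_of_commute (shift_comm u w)))
    (weylComm_clockZ_shift (modeSite i) w)) (hω.weylComm_of_commute (shift_comm v w))
  simpa using this

theorem weylComm_gamma_clockZ (i : Fin (2 * n)) (k : Fin n) :
    WeylComm (omega D n) (gamma D n i) (clockZ D n k) (-modeShift D i k) := by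
  obtain ⟨c, u, v, hc, h, huv⟩ := gamma_eq (D := D) i
  have hω := isPhase_omega (D := D) (n := n)
  rw [h, ← huv]
  have := hω.weylComm_mul_left (hω.weylComm_mul_left (hω.weylComm_mul_left
    (hω.weylComm_of_commute (hc (clockZ D n k)))
    (hω.weylComm_symm (weylComm_clockZ_shift k u)))
    (hω.weylComm_of_commute (clockZ_comm (modeSite i) k)))
    (hω.weylComm_symm (weylComm_clockZ_shift k v))
  convert this using 1
  rw [Pi.add_apply]
  ring

/-- The shift of the later mode covers the site of the earlier clock, while the shift of the earlier
mode does not reach the site of the later clock. Exactly one crossing contributes, also when the two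
modes share a site. -/
theorem weylComm_gamma {i j : Fin (2 * n)} (hij : i < j) :
    WeylComm (omega D n) (gamma D n i) (gamma D n j) (1 : ZMod D) := by
  obtain ⟨c, u, v, hc, h, huv⟩ := gamma_eq (D := D) j
  have hω := isPhase_omega (D := D) (n := n)
  rw [h]
  have := hω.weylComm_mul_right (hω.weylComm_mul_right (hω.weylComm_mul_right
    (hω.weylComm_of_commute (hc (gamma D n i)).symm) (weylComm_gamma_shift i u))
    (weylComm_gamma_clockZ i (modeSite j))) (weylComm_gamma_shift i v)
  convert this using 1
  have h1 : u (modeSite i) + v (modeSite i) = 1 := by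
    rw [← Pi.add_apply, huv, modeShift, if_pos]
    simp only [modeSite]
    rw [Fin.lt_def] at hij
    omega
  have h2 : modeShift D i (modeSite j) = 0 := by
    rw [modeShift, if_neg]
    simp only [modeSite]
    rw [Fin.lt_def] at hij
    omega
  rw [h2, ← h1]
  ring

theorem exists_weylComm_gamma (i j : Fin (2 * n)) :
    ∃ t : ZMod D, WeylComm (omega D n) (gamma D n i) (gamma D n j) t := by
  have hω := isPhase_omega (D := D) (n := n)
  rcases lt_trichotomy i j with h | rfl | h
  · exact ⟨_, weylComm_gamma h⟩
  · exact ⟨_, hω.weylComm_of_commute (Commute.refl _)⟩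
  · exact ⟨_, hω.weylComm_symm (weylComm_gamma h)⟩

/-- The Jordan-Wigner string misses the site of the clock, so those factors commute. In an odd mode
the last shift does not commute with the clock; the resulting `ω ^ (-(D choose 2))` is cancelled by
the half phase. -/
theorem gamma_pow_dim (i : Fin (2 * n)) : gamma D n i ^ D = 1 := by
  have hω := isPhase_omega (D := D) (n := n)
  have h0 : (shift (fun k => if k < modeSite i then 1 else 0) * clockZ D n (modeSite i)) ^ D
      = 1 := by
    have := weylComm_clockZ_shift (D := D) (modeSite i) fun k => if k < modeSite i then 1 else 0
    rw [if_neg (lt_irrefl _), hω.weylComm_zero_iff] at this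
    rw [this.symm.mul_pow, shift_pow_dim, clockZ_pow_dim, one_mul]
  by_cases h : (i : ℕ) % 2 = 0
  · rw [gamma, if_pos h, jwString_eq]
    exact h0
  · rw [gamma, if_neg h, jwString_eq, mul_assoc, mul_assoc, (halfPhase_comm _).mul_pow,
      ← mul_assoc]
    have h1 : WeylComm (omega D n) (shift (fun k => if k < modeSite i then 1 else 0) *
        clockZ D n (modeSite i)) (shiftX D n (modeSite i)) (0 + 1 : ZMod D) := by
      refine hω.weylComm_mul_left (hω.weylComm_of_commute (shift_comm _ _)) ?_
      simpa [shiftX_eq] using weylComm_clockZ_shift (D := D) (modeSite i) (Pi.single (modeSite i) 1)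
    have h2 := hω.mul_pow_of_weylComm h1 D
    rw [h0, shiftX_eq, shift_pow_dim, mul_one, mul_one] at h2
    rw [halfPhase_pow_dim]
    refine (congrArg _ h2).trans ?_
    rw [← hω.phase_add]
    simp [IsPhase.phase_zero]

/-! ### Parity -/

theorem weylComm_gamma_charge (i : Fin (2 * n)) :
    WeylComm (omega D n) (gamma D n i) (shift 1) (1 : ZMod D) :=
  weylComm_gamma_shift i 1

/-- Each mode has exponent `1` with `shift 1`, so the exponent of a monomial is the sum of its
entries. This makes the charge independent of the chosen presentation `ω^c γ^α`. -/
theorem HasParity.weylComm {W : Op D n} {t : ZMod D} (h : HasParity W t) :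
    WeylComm (omega D n) W (shift 1) t := by
  obtain ⟨c, α, rfl, rfl⟩ := h
  have hω := isPhase_omega (D := D) (n := n)
  have h1 := hω.weylComm_list_prod (List.finRange (2 * n)) (fun i => gamma D n i ^ (α i).val)
    (fun i => (α i).val * 1) (V := shift 1)
    fun i => hω.weylComm_pow_left (weylComm_gamma_charge i) _
  have h2 := hω.weylComm_mul_left (hω.weylComm_of_commute ((hω.central (shift 1)).pow_left c)) h1
  rw [zero_add] at h2
  convert h2 using 1
  · rw [monomial, List.ofFn_eq_map]
  · rw [Fin.sum_univ_def]; simp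

/-- The normal form writes `W` as a monomial with integer exponents, which `gamma_pow_dim` reduces
modulo `D`; its charge is then forced to equal the exponent with `shift 1`. -/
theorem hasParity_of_mem {W : Op D n} (hW : W ∈ PF D n) {t : ZMod D}
    (h : WeylComm (omega D n) W (shift 1) t) : HasParity W t := by
  have hω := isPhase_omega (D := D) (n := n)
  obtain ⟨c, a, ha⟩ := hω.exists_list_prod_of_mem_closure (gamma D n) exists_weylComm_gamma
    (List.finRange (2 * n)) (List.nodup_finRange _) (List.mem_finRange) hW
  have h1 : HasParity W (∑ i, (a i : ZMod D)) := by
    refine ⟨c.val, fun i => a i, ?_, rfl⟩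
    rw [ha, monomial, List.ofFn_eq_map, phase]
    congr 2
    refine List.map_congr_left fun i _ => ?_
    rw [← zpow_natCast, ZMod.val_intCast]
    exact zpow_eq_zpow_emod' _ (gamma_pow_dim i)
  rwa [hω.weylComm_unique h h1.weylComm]

theorem HasParity.unique {W : Op D n} {s t : ZMod D} (hs : HasParity W s) (ht : HasParity W t) :
    s = t :=
  isPhase_omega.weylComm_unique hs.weylComm ht.weylComm

/-! ### The dimension of a code space -/

/-- Conjugation by `V` preserves the trace of `U` but also multiplies it by a root of unity
different from `1`. -/
theorem trace_eq_zero_of_weylComm {U V : Op D n} {t : ZMod D} (ht : t ≠ 0)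
    (h : WeylComm (omega D n) U V t) :
    (U : Matrix (Fin n → ZMod D) (Fin n → ZMod D) ℂ).trace = 0 := by
  have h1 := congrArg (fun W : Op D n => (W : Matrix (Fin n → ZMod D) (Fin n → ZMod D) ℂ).trace)
    (isPhase_omega.conj_eq_of_weylComm h)
  simp only [Submonoid.coe_mul, coe_phase, Matrix.smul_mul, Matrix.one_mul,
    Matrix.trace_smul] at h1
  rw [Matrix.mul_assoc, Matrix.trace_mul_comm, Matrix.mul_assoc, ← Submonoid.coe_mul,
    mul_inv_cancel, Submonoid.coe_one, Matrix.mul_one, smul_eq_mul] at h1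
  by_contra h2
  have h3 : ZMod.stdAddChar t = 1 := mul_right_cancel₀ h2 (h1.symm.trans (one_mul _).symm)
  exact ht (ZMod.injective_stdAddChar (h3.trans (AddChar.map_zero_eq_one _).symm))

/-- The average over `S` projects onto the code space, so its trace is the dimension. By hypothesis
every element except `1` has trace zero, and `1` contributes `D ^ n`. -/
theorem finrank_codeSpace_mul_card (S : Subgroup (Op D n)) [Finite S]
    (hS : ∀ W ∈ S, W ≠ 1 → ∃ (V : Op D n) (t : ZMod D), t ≠ 0 ∧ WeylComm (omega D n) W V t) :
    Module.finrank ℂ (codeSpace S) * Nat.card S = D ^ n := by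
  classical
  have := Fintype.ofFinite S
  let ρ : Representation ℂ S ((Fin n → ZMod D) → ℂ) :=
    { toFun := fun W => Matrix.toLin' W.1.1
      map_one' := by simp; rfl
      map_mul' := fun U V => by
        rw [Subgroup.coe_mul, Submonoid.coe_mul, Matrix.toLin'_mul]; rfl }
  have hinv : ρ.invariants = codeSpace S := by
    ext ψ
    exact ⟨fun h W hW => h ⟨W, hW⟩, fun h W => h W W.2⟩
  have hcard : (Fintype.card S : ℂ) ≠ 0 := Nat.cast_ne_zero.2 Fintype.card_ne_zero
  let _ := invertibleOfNonzero hcard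
  have htr : ∀ W : S, LinearMap.trace ℂ _ (ρ W) = if W = 1 then (D : ℂ) ^ n else 0 := by
    intro W
    have h0 : LinearMap.trace ℂ _ (ρ W) = W.1.1.trace :=
      Matrix.trace_toLin'_eq _
    rw [h0]
    split_ifs with h
    · rw [h]
      simp [ZMod.card]
    · obtain ⟨V, t, ht, hV⟩ := hS W W.2 fun h' => h (Subtype.ext h')
      exact trace_eq_zero_of_weylComm ht hV
  have h1 := (ρ.isProj_averageMap).trace
  rw [hinv, Representation.averageMap, GroupAlgebra.average, map_smul, map_sum, map_smul,
    map_sum] at h1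
  simp only [Representation.asAlgebraHom_single_one, MonoidAlgebra.of_apply, htr,
    Finset.sum_ite_eq', Finset.mem_univ, if_true, smul_eq_mul] at h1
  rw [Nat.card_eq_fintype_card]
  have h2 : (Module.finrank ℂ (codeSpace S) : ℂ) * (Fintype.card S : ℂ) = (D : ℂ) ^ n := by
    rw [← h1, mul_comm, ← mul_assoc, mul_invOf_self, one_mul]
  exact_mod_cast h2

end Parafermion

/-! ### Abstract systems of Weyl pairs with extra commuting generators -/

namespace WeylSystem

set_option linter.unusedSectionVars false

/-- Families `X`, `Z`, `Q`, `E` of operators that generate `Γ`. The `X i`, `Z i` are Weyl pairs,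
the `Q i` commute with them and with each other, and `E i` detects `Q i`. The operators `η X i` and
`η Z i` have order dividing `D`. -/
structure SiteSystem {G : Type*} [Group G] {ι : Type*} [DecidableEq ι] (D : ℕ) (ω η : G)
    (Γ : Subgroup G) (E X Z Q : ι → G) : Prop where
  phase : IsPhase D ω
  η_comm : ∀ g, Commute η g
  gen : Γ = Subgroup.closure (Set.range (Sum.elim (Sum.elim E X) (Sum.elim Z Q)))
  XX : ∀ i j, Commute (X i) (X j)
  ZZ : ∀ i j, Commute (Z i) (Z j)
  QQ : ∀ i j, Commute (Q i) (Q j)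
  XQ : ∀ i j, Commute (X i) (Q j)
  ZQ : ∀ i j, Commute (Z i) (Q j)
  ZX : ∀ i j, WeylComm ω (Z i) (X j) (if j = i then 1 else 0 : ZMod D)
  EQ : ∀ i j, WeylComm ω (E i) (Q j) (if j = i then 1 else 0 : ZMod D)
  EX : ∀ i j, ∃ t : ZMod D, WeylComm ω (E i) (X j) t
  EZ : ∀ i j, ∃ t : ZMod D, WeylComm ω (E i) (Z j) t
  EE : ∀ i j, ∃ t : ZMod D, WeylComm ω (E i) (E j) t
  X_pow : ∀ i, (η * X i) ^ D = 1
  Z_pow : ∀ i, (η * Z i) ^ D = 1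
  Q_pow : ∀ i, Q i ^ D = 1
  E_pow : ∀ i, E i ^ D = 1
  X_pow_mem : ∀ i, X i ^ D ∈ Subgroup.zpowers ω
  Z_pow_mem : ∀ i, Z i ^ D ∈ Subgroup.zpowers ω

namespace SiteSystem

variable {G : Type*} [Group G] {ι : Type*} [Fintype ι] [DecidableEq ι] {D : ℕ} [NeZero D]
  {ω η : G} {Γ : Subgroup G} {E X Z Q : ι → G} (h : SiteSystem D ω η Γ E X Z Q)
include h

theorem comm_η_mul {U V : G} (hUV : Commute U V) : Commute (η * U) (η * V) :=
  ((h.η_comm _).mul_left ((h.η_comm _).symm.mul_right hUV))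

/-- The operator `∏ i, (η X i) ^ x i`. -/
noncomputable def homX : Multiplicative (ι → ZMod D) →* G :=
  piHom (fun i => η * X i) (fun i j => h.comm_η_mul (h.XX i j)) h.X_pow

/-- The operator `∏ i, (η Z i) ^ z i`. -/
noncomputable def homZ : Multiplicative (ι → ZMod D) →* G :=
  piHom (fun i => η * Z i) (fun i j => h.comm_η_mul (h.ZZ i j)) h.Z_pow

/-- The operator `∏ i, Q i ^ w i`. -/
noncomputable def homQ : Multiplicative (ι → ZMod D) →* G :=
  piHom Q h.QQ h.Q_pow

theorem homX_single (i : ι) : h.homX (.ofAdd (Pi.single i 1)) = η * X i :=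
  piHom_single _ _ _ i

theorem homZ_single (i : ι) : h.homZ (.ofAdd (Pi.single i 1)) = η * Z i :=
  piHom_single _ _ _ i

theorem homQ_single (i : ι) : h.homQ (.ofAdd (Pi.single i 1)) = Q i :=
  piHom_single _ _ _ i

theorem weylComm_η_mul {U V : G} {t : ZMod D} (hUV : WeylComm ω U V t) :
    WeylComm ω U (η * V) t := by
  simpa using h.phase.weylComm_mul_right (h.phase.weylComm_of_commute (h.η_comm U).symm) hUV

theorem weylComm_homX {V : G} (s : ι → ZMod D) (hV : ∀ i, WeylComm ω V (X i) (s i))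
    (x : ι → ZMod D) : WeylComm ω V (h.homX (.ofAdd x)) (s ⬝ᵥ x) :=
  h.phase.weylComm_hom _ s (fun i => by rw [homX_single]; exact h.weylComm_η_mul (hV i)) x

theorem weylComm_homZ {V : G} (s : ι → ZMod D) (hV : ∀ i, WeylComm ω V (Z i) (s i))
    (z : ι → ZMod D) : WeylComm ω V (h.homZ (.ofAdd z)) (s ⬝ᵥ z) :=
  h.phase.weylComm_hom _ s (fun i => by rw [homZ_single]; exact h.weylComm_η_mul (hV i)) z

theorem weylComm_homQ {V : G} (s : ι → ZMod D) (hV : ∀ i, WeylComm ω V (Q i) (s i))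
    (w : ι → ZMod D) : WeylComm ω V (h.homQ (.ofAdd w)) (s ⬝ᵥ w) :=
  h.phase.weylComm_hom _ s (fun i => by rw [homQ_single]; exact hV i) w

theorem commute_homX {V : G} (hV : ∀ i, Commute V (X i)) (x : ι → ZMod D) :
    Commute V (h.homX (.ofAdd x)) := by
  simpa [h.phase.weylComm_zero_iff] using
    h.weylComm_homX 0 (fun i => h.phase.weylComm_of_commute (hV i)) x

theorem commute_homZ {V : G} (hV : ∀ i, Commute V (Z i)) (z : ι → ZMod D) :
    Commute V (h.homZ (.ofAdd z)) := by
  simpa [h.phase.weylComm_zero_iff] using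
    h.weylComm_homZ 0 (fun i => h.phase.weylComm_of_commute (hV i)) z

theorem commute_homQ {V : G} (hV : ∀ i, Commute V (Q i)) (w : ι → ZMod D) :
    Commute V (h.homQ (.ofAdd w)) := by
  simpa [h.phase.weylComm_zero_iff] using
    h.weylComm_homQ 0 (fun i => h.phase.weylComm_of_commute (hV i)) w

theorem weylComm_Z_homX (i : ι) (x : ι → ZMod D) :
    WeylComm ω (Z i) (h.homX (.ofAdd x)) (x i) := by
  simpa [dotProduct] using h.weylComm_homX (fun j => if j = i then 1 else 0) (h.ZX i) x

theorem weylComm_homX_Z (i : ι) (x : ι → ZMod D) :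
    WeylComm ω (h.homX (.ofAdd x)) (Z i) (-x i) :=
  h.phase.weylComm_symm (h.weylComm_Z_homX i x)

theorem weylComm_homX_homZ (x z : ι → ZMod D) :
    WeylComm ω (h.homX (.ofAdd x)) (h.homZ (.ofAdd z)) (-(z ⬝ᵥ x)) := by
  have := h.weylComm_homZ (fun i => -x i) (fun i => h.weylComm_homX_Z i x) z
  convert this using 1
  simp [dotProduct, mul_comm]

theorem weylComm_homZ_homX (x z : ι → ZMod D) :
    WeylComm ω (h.homZ (.ofAdd z)) (h.homX (.ofAdd x)) (z ⬝ᵥ x) := by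
  simpa using h.phase.weylComm_symm (h.weylComm_homX_homZ x z)

theorem weylComm_homZ_X (i : ι) (z : ι → ZMod D) :
    WeylComm ω (h.homZ (.ofAdd z)) (X i) (z i) := by
  have := h.phase.weylComm_symm (h.weylComm_homZ (V := X i) (fun j => -if i = j then 1 else 0)
    (fun j => h.phase.weylComm_symm (h.ZX j i)) z)
  simpa [dotProduct] using this

theorem weylComm_E_homQ (i : ι) (w : ι → ZMod D) :
    WeylComm ω (E i) (h.homQ (.ofAdd w)) (w i) := by
  simpa [dotProduct] using h.weylComm_homQ (fun j => if j = i then 1 else 0) (h.EQ i) w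

theorem commute_homX_X (x : ι → ZMod D) (i : ι) : Commute (h.homX (.ofAdd x)) (X i) :=
  (h.commute_homX (h.XX i) x).symm

theorem commute_homZ_Z (z : ι → ZMod D) (i : ι) : Commute (h.homZ (.ofAdd z)) (Z i) :=
  (h.commute_homZ (h.ZZ i) z).symm

theorem commute_homX_Q (x : ι → ZMod D) (i : ι) : Commute (h.homX (.ofAdd x)) (Q i) :=
  (h.commute_homX (fun j => (h.XQ j i).symm) x).symm

theorem commute_homZ_Q (z : ι → ZMod D) (i : ι) : Commute (h.homZ (.ofAdd z)) (Q i) :=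
  (h.commute_homZ (fun j => (h.ZQ j i).symm) z).symm

theorem commute_homQ_X (w : ι → ZMod D) (i : ι) : Commute (h.homQ (.ofAdd w)) (X i) :=
  (h.commute_homQ (h.XQ i) w).symm

theorem commute_homQ_Z (w : ι → ZMod D) (i : ι) : Commute (h.homQ (.ofAdd w)) (Z i) :=
  (h.commute_homQ (h.ZQ i) w).symm

theorem commute_homQ_Q (w : ι → ZMod D) (i : ι) : Commute (h.homQ (.ofAdd w)) (Q i) :=
  (h.commute_homQ (h.QQ i) w).symm

/-! ### The words `X^x Z^z Q^w` -/

/-- The operator `X^x Z^z Q^w`, with normalized phases. -/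
noncomputable def word (x z w : ι → ZMod D) : G :=
  h.homX (.ofAdd x) * h.homZ (.ofAdd z) * h.homQ (.ofAdd w)

theorem word_zero : h.word 0 0 0 = 1 := by
  simp [word]

/-- The only noncommuting exchange is that of `Z^z` with `X^x'`, whose exponent is `z ⬝ᵥ x'`. -/
theorem word_mul {x z w x' z' w' : ι → ZMod D} (hz : z ⬝ᵥ x' = 0) :
    h.word x z w * h.word x' z' w' = h.word (x + x') (z + z') (w + w') := by
  have h1 : Commute (h.homZ (.ofAdd z)) (h.homX (.ofAdd x')) := by
    have := h.weylComm_homZ_homX x' z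
    rwa [hz, h.phase.weylComm_zero_iff] at this
  have h2 : Commute (h.homQ (.ofAdd w)) (h.homX (.ofAdd x') * h.homZ (.ofAdd z')) :=
    (h.commute_homX (h.commute_homQ_X w) x').mul_right (h.commute_homZ (h.commute_homQ_Z w) z')
  unfold word
  rw [ofAdd_add, ofAdd_add, ofAdd_add, map_mul, map_mul, map_mul]
  calc _ = h.homX (.ofAdd x) * h.homZ (.ofAdd z) *
        (h.homQ (.ofAdd w) * (h.homX (.ofAdd x') * h.homZ (.ofAdd z'))) * h.homQ (.ofAdd w') := by
          group
    _ = h.homX (.ofAdd x) * (h.homZ (.ofAdd z) * h.homX (.ofAdd x')) * h.homZ (.ofAdd z') *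
        h.homQ (.ofAdd w) * h.homQ (.ofAdd w') := by rw [h2.eq]; group
    _ = _ := by rw [h1.eq]; group

theorem weylComm_Z_word (i : ι) (x z w : ι → ZMod D) : WeylComm ω (Z i) (h.word x z w) (x i) := by
  simpa [word] using h.phase.weylComm_mul_right (h.phase.weylComm_mul_right (h.weylComm_Z_homX i x)
    (h.phase.weylComm_of_commute (h.commute_homZ_Z z i).symm))
    (h.phase.weylComm_of_commute (h.commute_homQ_Z w i).symm)

theorem weylComm_X_word (i : ι) (x z w : ι → ZMod D) :
    WeylComm ω (X i) (h.word x z w) (-z i) := by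
  simpa [word] using h.phase.weylComm_mul_right (h.phase.weylComm_mul_right
    (h.phase.weylComm_of_commute (h.commute_homX_X x i).symm)
    (h.phase.weylComm_symm (h.weylComm_homZ_X i z)))
    (h.phase.weylComm_of_commute (h.commute_homQ_X w i).symm)

/-- The exponents with `Z i` and `X i` read off `x i` and `-z i`. The phases of `E i` with `X` and
`Z` are unspecified, so `E i` can read off `w i` only after the `X` and `Z` parts have been
cancelled. -/
theorem word_injective {x z w x' z' w' : ι → ZMod D} (he : h.word x z w = h.word x' z' w') :
    x = x' ∧ z = z' ∧ w = w' := by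
  have hx : x = x' := funext fun i =>
    h.phase.weylComm_unique (h.weylComm_Z_word i x z w) (he ▸ h.weylComm_Z_word i x' z' w')
  have hz : z = z' := funext fun i => neg_injective
    (h.phase.weylComm_unique (h.weylComm_X_word i x z w) (he ▸ h.weylComm_X_word i x' z' w'))
  refine ⟨hx, hz, ?_⟩
  subst hx hz
  have hq := mul_left_cancel he
  exact funext fun i =>
    h.phase.weylComm_unique (h.weylComm_E_homQ i w) (hq ▸ h.weylComm_E_homQ i w')

theorem exists_weylComm_word {x z w : ι → ZMod D} (hne : h.word x z w ≠ 1) :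
    ∃ (V : G) (t : ZMod D), t ≠ 0 ∧ WeylComm ω (h.word x z w) V t := by
  by_contra! hcon
  apply hne
  have hx : x = 0 := funext fun i => by
    by_contra hi
    exact hcon _ _ (neg_ne_zero.2 hi) (h.phase.weylComm_symm (h.weylComm_Z_word i x z w))
  have hz : z = 0 := funext fun i => by
    by_contra hi
    exact hcon _ _ (neg_ne_zero.2 (neg_ne_zero.2 hi))
      (h.phase.weylComm_symm (h.weylComm_X_word i x z w))
  subst hx hz
  have hw : w = 0 := funext fun i => by
    by_contra hi
    refine hcon (E i) _ (neg_ne_zero.2 hi) ?_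
    simpa [word] using h.phase.weylComm_symm (h.weylComm_E_homQ i w)
  rw [hw, h.word_zero]

/-- The group of all words `X^x Z^z Q^w` with `x ∈ LX`, `z ∈ LZ` and `w ∈ LQ`, for orthogonal `LX`
and `LZ`. -/
noncomputable def wordGroup (LX LZ LQ : AddSubgroup (ι → ZMod D))
    (ho : ∀ x ∈ LX, ∀ z ∈ LZ, z ⬝ᵥ x = 0) : Subgroup G where
  carrier := {W | ∃ x ∈ LX, ∃ z ∈ LZ, ∃ w ∈ LQ, W = h.word x z w}
  one_mem' := ⟨0, zero_mem _, 0, zero_mem _, 0, zero_mem _, h.word_zero.symm⟩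
  mul_mem' := by
    rintro _ _ ⟨x, hx, z, hz, w, hw, rfl⟩ ⟨x', hx', z', hz', w', hw', rfl⟩
    exact ⟨_, add_mem hx hx', _, add_mem hz hz', _, add_mem hw hw',
      h.word_mul (ho x' hx' z hz)⟩
  inv_mem' := by
    rintro _ ⟨x, hx, z, hz, w, hw, rfl⟩
    refine ⟨-x, neg_mem hx, -z, neg_mem hz, -w, neg_mem hw, ?_⟩
    rw [inv_eq_iff_mul_eq_one, h.word_mul (ho _ (neg_mem hx) z hz)]
    simp [word_zero]

variable {LX LZ LQ : AddSubgroup (ι → ZMod D)} {ho : ∀ x ∈ LX, ∀ z ∈ LZ, z ⬝ᵥ x = 0}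

theorem homX_mem_wordGroup {x : ι → ZMod D} (hx : x ∈ LX) :
    h.homX (.ofAdd x) ∈ h.wordGroup LX LZ LQ ho :=
  ⟨x, hx, 0, zero_mem _, 0, zero_mem _, by simp [word]⟩

theorem homZ_mem_wordGroup {z : ι → ZMod D} (hz : z ∈ LZ) :
    h.homZ (.ofAdd z) ∈ h.wordGroup LX LZ LQ ho :=
  ⟨0, zero_mem _, z, hz, 0, zero_mem _, by simp [word]⟩

theorem homQ_mem_wordGroup {w : ι → ZMod D} (hw : w ∈ LQ) :
    h.homQ (.ofAdd w) ∈ h.wordGroup LX LZ LQ ho :=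
  ⟨0, zero_mem _, 0, zero_mem _, w, hw, by simp [word]⟩

theorem wordGroup_le {H : Subgroup G} (hX : ∀ x ∈ LX, h.homX (.ofAdd x) ∈ H)
    (hZ : ∀ z ∈ LZ, h.homZ (.ofAdd z) ∈ H) (hQ : ∀ w ∈ LQ, h.homQ (.ofAdd w) ∈ H) :
    h.wordGroup LX LZ LQ ho ≤ H := by
  rintro _ ⟨x, hx, z, hz, w, hw, rfl⟩
  exact mul_mem (mul_mem (hX x hx) (hZ z hz)) (hQ w hw)

theorem wordGroup_commute {U V : G} (hU : U ∈ h.wordGroup LX LZ LQ ho)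
    (hV : V ∈ h.wordGroup LX LZ LQ ho) : Commute U V := by
  obtain ⟨x, hx, z, hz, w, hw, rfl⟩ := hU
  obtain ⟨x', hx', z', hz', w', hw', rfl⟩ := hV
  rw [Commute, SemiconjBy, h.word_mul (ho x' hx' z hz), h.word_mul (ho x hx z' hz'), add_comm x,
    add_comm z, add_comm w]

theorem exists_weylComm_of_mem_wordGroup {W : G} (hW : W ∈ h.wordGroup LX LZ LQ ho)
    (hne : W ≠ 1) : ∃ (V : G) (t : ZMod D), t ≠ 0 ∧ WeylComm ω W V t := by
  obtain ⟨x, hx, z, hz, w, hw, rfl⟩ := hW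
  exact h.exists_weylComm_word hne

theorem eq_one_of_mem_wordGroup {j : ℕ} (hW : ω ^ j ∈ h.wordGroup LX LZ LQ ho) : ω ^ j = 1 := by
  by_contra hne
  obtain ⟨V, t, ht, hV⟩ := h.exists_weylComm_of_mem_wordGroup hW hne
  exact ht ((h.phase.weylComm_commute hV).1 ((h.phase.central V).pow_left j))

/-- The group of words is in bijection with the triples of exponents. -/
noncomputable def wordGroupEquiv (LX LZ LQ : AddSubgroup (ι → ZMod D))
    (ho : ∀ x ∈ LX, ∀ z ∈ LZ, z ⬝ᵥ x = 0) : LX × LZ × LQ ≃ h.wordGroup LX LZ LQ ho :=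
  Equiv.ofBijective
    (fun v => ⟨h.word v.1 v.2.1 v.2.2, v.1, v.1.2, v.2.1, v.2.1.2, v.2.2, v.2.2.2, rfl⟩) <| by
      constructor
      · rintro ⟨x, z, w⟩ ⟨x', z', w'⟩ he
        obtain ⟨h1, h2, h3⟩ := h.word_injective (congrArg Subtype.val he)
        exact Prod.ext (Subtype.ext h1) (Prod.ext (Subtype.ext h2) (Subtype.ext h3))
      · rintro ⟨_, x, hx, z, hz, w, hw, rfl⟩
        exact ⟨(⟨x, hx⟩, ⟨z, hz⟩, ⟨w, hw⟩), rfl⟩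

theorem finite_wordGroup : Finite (h.wordGroup LX LZ LQ ho) :=
  Finite.of_equiv _ (h.wordGroupEquiv LX LZ LQ ho)

theorem card_wordGroup :
    Nat.card (h.wordGroup LX LZ LQ ho) = Nat.card LX * (Nat.card LZ * Nat.card LQ) := by
  rw [← Nat.card_congr (h.wordGroupEquiv LX LZ LQ ho), Nat.card_prod, Nat.card_prod]

/-! ### The centralizer -/

theorem exists_weylComm_gen (k l : (ι ⊕ ι) ⊕ (ι ⊕ ι)) : ∃ t : ZMod D,
    WeylComm ω (Sum.elim (Sum.elim E X) (Sum.elim Z Q) k)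
      (Sum.elim (Sum.elim E X) (Sum.elim Z Q) l) t := by
  have hs : ∀ {U V : G}, (∃ t : ZMod D, WeylComm ω U V t) → ∃ t : ZMod D, WeylComm ω V U t :=
    fun ⟨t, ht⟩ => ⟨_, h.phase.weylComm_symm ht⟩
  have hc : ∀ {U V : G}, Commute U V → ∃ t : ZMod D, WeylComm ω U V t :=
    fun ht => ⟨_, h.phase.weylComm_of_commute ht⟩
  rcases k with (i | i) | (i | i) <;> rcases l with (j | j) | (j | j)
  · exact h.EE i j
  · exact h.EX i j
  · exact h.EZ i j
  · exact ⟨_, h.EQ i j⟩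
  · exact hs (h.EX j i)
  · exact hc (h.XX i j)
  · exact hs ⟨_, h.ZX j i⟩
  · exact hc (h.XQ i j)
  · exact hs (h.EZ j i)
  · exact ⟨_, h.ZX i j⟩
  · exact hc (h.ZZ i j)
  · exact hc (h.ZQ i j)
  · exact hs ⟨_, h.EQ j i⟩
  · exact hc (h.XQ j i).symm
  · exact hc (h.ZQ j i).symm
  · exact hc (h.QQ i j)

/-- Commutation up to a phase passes from the generators to all of `Γ`. This is what supplies
exponent vectors for an arbitrary candidate in the centralizer. -/
theorem exists_weylComm_of_mem {V W : G}
    (hV : ∀ k, ∃ t : ZMod D, WeylComm ω V (Sum.elim (Sum.elim E X) (Sum.elim Z Q) k) t)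
    (hW : W ∈ Γ) : ∃ t : ZMod D, WeylComm ω V W t := by
  rw [h.gen] at hW
  induction hW using Subgroup.closure_induction with
  | mem x hx => obtain ⟨k, rfl⟩ := hx; exact hV k
  | one => exact ⟨_, h.phase.weylComm_of_commute (Commute.one_right V)⟩
  | mul x y _ _ hx hy =>
    obtain ⟨s, hs⟩ := hx
    obtain ⟨t, ht⟩ := hy
    exact ⟨_, h.phase.weylComm_mul_right hs ht⟩
  | inv x _ hx =>
    obtain ⟨s, hs⟩ := hx
    exact ⟨_, h.phase.weylComm_inv_right hs⟩

/-- In the normal form of `W`, the exponents vanish modulo `D` by triangular elimination: `Q` sees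
only the `E` factors, then `Z` sees only `X`, `X` only `Z`, and finally `E` only `Q`. The
unspecified phases of `E` always meet exponents already known to be zero. The surviving factors are
powers of `D`-th powers, which are scalars. -/
theorem mem_zpowers_of_commute {W : G} (hW : W ∈ Γ) (hE : ∀ i, Commute (E i) W)
    (hX : ∀ i, Commute (X i) W) (hZ : ∀ i, Commute (Z i) W) (hQ : ∀ i, Commute (Q i) W) :
    W ∈ Subgroup.zpowers ω := by
  classical
  set g : (ι ⊕ ι) ⊕ (ι ⊕ ι) → G := Sum.elim (Sum.elim E X) (Sum.elim Z Q) with hg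
  obtain ⟨c, a, ha⟩ := h.phase.exists_list_prod_of_mem_closure g h.exists_weylComm_gen
    Finset.univ.toList (Finset.nodup_toList _) (by simp) (h.gen ▸ hW)
  -- The exponent of `W` with `V`, computed from the normal form, must be zero: each commuting `V`
  -- gives one linear equation for `a`.
  have key : ∀ {V : G} (s : (ι ⊕ ι) ⊕ (ι ⊕ ι) → ZMod D), (∀ k, WeylComm ω (g k) V (s k)) →
      Commute V W → ∑ k, (a k : ZMod D) * s k = 0 := by
    intro V s hs hV
    have h1 := h.phase.weylComm_list_prod Finset.univ.toList (fun k => g k ^ a k) _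
      fun k => h.phase.weylComm_zpow_left (hs k) (a k)
    have h2 := h.phase.weylComm_mul_left (h.phase.weylComm_of_commute (h.phase.phase_comm c V)) h1
    rw [← ha, Finset.sum_map_toList, zero_add] at h2
    exact (h.phase.weylComm_commute h2).1 hV.symm
  have haE : ∀ i, (a (.inl (.inl i)) : ZMod D) = 0 := by
    intro i
    have := key (V := Q i) (Sum.elim (Sum.elim (fun j => if i = j then 1 else 0) 0) 0) (by
      rintro ((j | j) | (j | j))
      · exact h.EQ j i
      · exact h.phase.weylComm_of_commute (h.XQ j i)
      · exact h.phase.weylComm_of_commute (h.ZQ j i)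
      · exact h.phase.weylComm_of_commute (h.QQ j i)) (hQ i)
    simpa [Fintype.sum_sum_type] using this
  have ex : ∀ l, ∃ t : (ι ⊕ ι) ⊕ (ι ⊕ ι) → ZMod D, ∀ k, WeylComm ω (g k) (g l) (t k) :=
    fun l => ⟨_, fun k => (h.exists_weylComm_gen k l).choose_spec⟩
  have haX : ∀ i, (a (.inl (.inr i)) : ZMod D) = 0 := by
    intro i
    obtain ⟨t, ht⟩ := ex (.inr (.inl i))
    have h1 : ∀ j, t (.inl (.inr j)) = -if j = i then 1 else 0 := fun j =>
      h.phase.weylComm_unique (ht _) (h.phase.weylComm_symm (h.ZX i j))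
    have h2 : ∀ j, t (.inr (.inl j)) = 0 := fun j =>
      h.phase.weylComm_unique (ht _) (h.phase.weylComm_of_commute (h.ZZ j i))
    have h3 : ∀ j, t (.inr (.inr j)) = 0 := fun j =>
      h.phase.weylComm_unique (ht _) (h.phase.weylComm_of_commute (h.ZQ i j).symm)
    simpa [Fintype.sum_sum_type, haE, h1, h2, h3] using key t ht (hZ i)
  have haZ : ∀ i, (a (.inr (.inl i)) : ZMod D) = 0 := by
    intro i
    obtain ⟨t, ht⟩ := ex (.inl (.inr i))
    have h1 : ∀ j, t (.inr (.inl j)) = if i = j then 1 else 0 := fun j =>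
      h.phase.weylComm_unique (ht _) (h.ZX j i)
    have h2 : ∀ j, t (.inr (.inr j)) = 0 := fun j =>
      h.phase.weylComm_unique (ht _) (h.phase.weylComm_of_commute (h.XQ i j).symm)
    simpa [Fintype.sum_sum_type, haE, haX, h1, h2] using key t ht (hX i)
  have haQ : ∀ i, (a (.inr (.inr i)) : ZMod D) = 0 := by
    intro i
    obtain ⟨t, ht⟩ := ex (.inl (.inl i))
    have h1 : ∀ j, t (.inr (.inr j)) = -if j = i then 1 else 0 := fun j =>
      h.phase.weylComm_unique (ht _) (h.phase.weylComm_symm (h.EQ i j))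
    simpa [Fintype.sum_sum_type, haE, haX, haZ, h1] using key t ht (hE i)
  have hmem : ∀ k, g k ^ a k ∈ Subgroup.zpowers ω := by
    intro k
    have h1 : (a k : ZMod D) = 0 := by
      rcases k with (j | j) | (j | j)
      exacts [haE j, haX j, haZ j, haQ j]
    obtain ⟨b, hb⟩ := (ZMod.intCast_zmod_eq_zero_iff_dvd _ _).1 h1
    rw [hb, zpow_mul, zpow_natCast]
    refine zpow_mem ?_ b
    rcases k with (j | j) | (j | j)
    · change E j ^ D ∈ _; rw [h.E_pow]; exact one_mem _
    · exact h.X_pow_mem j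
    · exact h.Z_pow_mem j
    · change Q j ^ D ∈ _; rw [h.Q_pow]; exact one_mem _
  rw [ha]
  refine mul_mem (h.phase.mem_zpowers_iff.2 ⟨c, rfl⟩) (list_prod_mem ?_)
  simp only [List.mem_map]
  rintro _ ⟨k, -, rfl⟩
  exact hmem k

/-- The exponents of `W` with all `Z i` and `X i` tell which `X` and `Z` words to divide by. That
`W` commutes with the word group makes these vectors orthogonal to `LZ` and `LX`, so `hX` and `hZ`
put the words in `H` up to central factors. After a further division by a `Q` word only a power of
`ω` is left. -/
theorem mem_of_commute_wordGroup {H : Subgroup G} (hH : H ≤ Γ) (hω : ω ∈ H)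
    (hS : h.wordGroup LX LZ ⊤ ho ≤ H)
    (hX : ∀ x, (∀ z ∈ LZ, z ⬝ᵥ x = 0) → ∃ c, (∀ g, Commute c g) ∧ c * h.homX (.ofAdd x) ∈ H)
    (hZ : ∀ z, (∀ x ∈ LX, z ⬝ᵥ x = 0) → ∃ c, (∀ g, Commute c g) ∧ c * h.homZ (.ofAdd z) ∈ H)
    {W : G} (hW : W ∈ Γ) (hWS : ∀ V ∈ h.wordGroup LX LZ ⊤ ho, Commute V W) : W ∈ H := by
  have hQW : ∀ i, Commute (Q i) W := fun i => by
    rw [← h.homQ_single]; exact hWS _ (h.homQ_mem_wordGroup (AddSubgroup.mem_top _))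
  have hc : ∀ {c : G} {U V : G} {t : ZMod D}, (∀ g, Commute c g) → WeylComm ω U V t →
      WeylComm ω U (c * V) t := by
    intro c U V t hc hUV
    simpa using h.phase.weylComm_mul_right (h.phase.weylComm_of_commute (hc U).symm) hUV
  choose x hx using fun i =>
    h.exists_weylComm_of_mem (V := Z i) (h.exists_weylComm_gen (.inr (.inl i))) hW
  choose z hz using fun i =>
    h.exists_weylComm_of_mem (V := X i) (h.exists_weylComm_gen (.inl (.inr i))) hW
  obtain ⟨c, hcc, hcx⟩ := hX x fun z' hz' => by
    have h1 := h.weylComm_homZ (V := W) (fun i => -x i) (fun i => h.phase.weylComm_symm (hx i)) z'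
    have h2 := (h.phase.weylComm_commute h1).1 (hWS _ (h.homZ_mem_wordGroup hz')).symm
    have h3 : z' ⬝ᵥ x = -((fun i => -x i) ⬝ᵥ z') := by simp [dotProduct, mul_comm]
    rw [h3, h2, neg_zero]
  -- The sign is needed because `X i` has exponent `-z i` with `Z^z`.
  obtain ⟨c', hcc', hcz⟩ := hZ (-z) fun x' hx' => by
    have h1 := h.weylComm_homX (V := W) (fun i => -z i) (fun i => h.phase.weylComm_symm (hz i)) x'
    exact (h.phase.weylComm_commute h1).1 (hWS _ (h.homX_mem_wordGroup hx')).symm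
  set U := (c * h.homX (.ofAdd x))⁻¹ * ((c' * h.homZ (.ofAdd (-z)))⁻¹ * W) with hU
  have hUΓ : U ∈ Γ := mul_mem (inv_mem (hH hcx)) (mul_mem (inv_mem (hH hcz)) hW)
  -- The vector `w` is read off from `U`, not from `W`: the `X` and `Z` words just removed have
  -- unspecified phases with `E i`.
  choose w hw using fun i =>
    h.exists_weylComm_of_mem (V := E i) (h.exists_weylComm_gen (.inl (.inl i))) hUΓ
  have hqw : h.homQ (.ofAdd w) ∈ H := hS (h.homQ_mem_wordGroup (AddSubgroup.mem_top _))
  have hUX : ∀ i, Commute (X i) U := fun i => by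
    have h1 := h.phase.weylComm_mul_right
      (h.phase.weylComm_inv_right
        (hc hcc (h.phase.weylComm_of_commute (h.commute_homX_X x i).symm)))
      (h.phase.weylComm_mul_right
        (h.phase.weylComm_inv_right (hc hcc' (h.phase.weylComm_symm (h.weylComm_homZ_X i (-z)))))
        (hz i))
    rwa [neg_zero, zero_add, neg_neg, Pi.neg_apply, neg_add_cancel,
      h.phase.weylComm_zero_iff] at h1
  have hUZ : ∀ i, Commute (Z i) U := fun i => by
    have h1 := h.phase.weylComm_mul_right
      (h.phase.weylComm_inv_right (hc hcc (h.weylComm_Z_homX i x)))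
      (h.phase.weylComm_mul_right (h.phase.weylComm_inv_right
        (hc hcc' (h.phase.weylComm_of_commute (h.commute_homZ_Z (-z) i).symm))) (hx i))
    rwa [neg_zero, zero_add, neg_add_cancel, h.phase.weylComm_zero_iff] at h1
  have hUQ : ∀ i, Commute (Q i) U := fun i =>
    ((hcc (Q i)).symm.mul_right (h.commute_homX_Q x i).symm).inv_right.mul_right
      (((hcc' (Q i)).symm.mul_right (h.commute_homZ_Q (-z) i).symm).inv_right.mul_right (hQW i))
  have hmem : (h.homQ (.ofAdd w))⁻¹ * U ∈ Subgroup.zpowers ω := by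
    refine h.mem_zpowers_of_commute (mul_mem (inv_mem (hH hqw)) hUΓ) (fun i => ?_)
      (fun i => (h.commute_homQ_X w i).symm.inv_right.mul_right (hUX i))
      (fun i => (h.commute_homQ_Z w i).symm.inv_right.mul_right (hUZ i))
      (fun i => (h.commute_homQ_Q w i).symm.inv_right.mul_right (hUQ i))
    have h1 := h.phase.weylComm_mul_right
      (h.phase.weylComm_inv_right (h.weylComm_E_homQ i w)) (hw i)
    rwa [neg_add_cancel, h.phase.weylComm_zero_iff] at h1
  have h2 : (h.homQ (.ofAdd w))⁻¹ * U ∈ H :=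
    (Subgroup.zpowers_le.2 hω) hmem
  have h3 : U ∈ H := (mul_mem_cancel_left (inv_mem hqw)).1 h2
  exact (mul_mem_cancel_left (inv_mem hcz)).1 ((mul_mem_cancel_left (inv_mem hcx)).1 h3)

/-- If `H` contains normalized words for `L` and for the vectors `ξ k`, up to central factors,
then also for the vectors in the span of `L` and the `ξ k`. -/
theorem exists_central_mul_mem {κ : Type*} [Fintype κ] (Φ : Multiplicative (ι → ZMod D) →* G)
    {H : Subgroup G} {L : AddSubgroup (ι → ZMod D)} {ξ : κ → ι → ZMod D}
    (hL : ∀ x ∈ L, Φ (.ofAdd x) ∈ H)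
    (hξ : ∀ k, ∃ c, (∀ g, Commute c g) ∧ c * Φ (.ofAdd (ξ k)) ∈ H) {x : ι → ZMod D}
    (hx : ∃ x₀ ∈ L, ∃ a : κ → ZMod D, x = x₀ + ∑ k, a k • ξ k) :
    ∃ c, (∀ g, Commute c g) ∧ c * Φ (.ofAdd x) ∈ H := by
  have hadd : ∀ x y, (∃ c, (∀ g, Commute c g) ∧ c * Φ (.ofAdd x) ∈ H) →
      (∃ c, (∀ g, Commute c g) ∧ c * Φ (.ofAdd y) ∈ H) →
      ∃ c, (∀ g, Commute c g) ∧ c * Φ (.ofAdd (x + y)) ∈ H := by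
    rintro x y ⟨c, hc, hx⟩ ⟨c', hc', hy⟩
    refine ⟨c * c', fun g => (hc g).mul_left (hc' g), ?_⟩
    have := mul_mem hx hy
    rwa [mul_assoc, ← mul_assoc _ c', ← (hc' _).eq, mul_assoc, ← map_mul, ← ofAdd_add,
      ← mul_assoc] at this
  have hzero : ∃ c, (∀ g, Commute c g) ∧ c * Φ (.ofAdd 0) ∈ H :=
    ⟨1, Commute.one_left, by simp⟩
  obtain ⟨x₀, hx₀, a, rfl⟩ := hx
  refine hadd _ _ ⟨1, Commute.one_left, by simpa using hL x₀ hx₀⟩ ?_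
  refine Finset.sum_induction _ (fun x => ∃ c, (∀ g, Commute c g) ∧ c * Φ (.ofAdd x) ∈ H)
    hadd hzero fun k _ => ?_
  have h1 : ∀ n : ℕ, ∃ c, (∀ g, Commute c g) ∧ c * Φ (.ofAdd (n • ξ k)) ∈ H := by
    intro n
    induction n with
    | zero => simpa using hzero
    | succ n ih => rw [succ_nsmul]; exact hadd _ _ ih (hξ k)
  have h2 : a k • ξ k = (a k).val • ξ k := by
    ext i
    rw [Pi.smul_apply, Pi.smul_apply, nsmul_eq_mul, ZMod.natCast_zmod_val, smul_eq_mul]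
  rw [h2]
  exact h1 _

end SiteSystem

end WeylSystem

namespace WeylSystem.SiteSystem

set_option linter.unusedSectionVars false

variable {G : Type*} [Group G] {ι : Type*} [Fintype ι] [DecidableEq ι] {D : ℕ} [NeZero D]
  {ω η : G} {Γ : Subgroup G} {E X Z Q : ι → G} (h : SiteSystem D ω η Γ E X Z Q)
include h

/-- Used to label sites by lattice edges, so that an arbitrary numbering plays no further role. -/
theorem reindex {κ : Type*} [DecidableEq κ] (e : κ ≃ ι) :
    SiteSystem D ω η Γ (fun k => E (e k)) (fun k => X (e k)) (fun k => Z (e k))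
      (fun k => Q (e k)) where
  phase := h.phase
  η_comm := h.η_comm
  gen := by
    have hr : ∀ f : ι → G, Set.range (fun k => f (e k)) = Set.range f := fun f =>
      e.surjective.range_comp f
    rw [h.gen]
    simp only [Set.Sum.elim_range, hr]
  XX _ _ := h.XX _ _
  ZZ _ _ := h.ZZ _ _
  QQ _ _ := h.QQ _ _
  XQ _ _ := h.XQ _ _
  ZQ _ _ := h.ZQ _ _
  ZX i j := by simpa using h.ZX (e i) (e j)
  EQ i j := by simpa using h.EQ (e i) (e j)
  EX _ _ := h.EX _ _
  EZ _ _ := h.EZ _ _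
  EE _ _ := h.EE _ _
  X_pow _ := h.X_pow _
  Z_pow _ := h.Z_pow _
  Q_pow _ := h.Q_pow _
  E_pow _ := h.E_pow _
  X_pow_mem _ := h.X_pow_mem _
  Z_pow_mem _ := h.Z_pow_mem _

end WeylSystem.SiteSystem

/-! ### The operators of four-mode sites form a site system -/

namespace Parafermion

open WeylSystem

set_option linter.unusedSectionVars false

section Sites

variable {D q m : ℕ} [NeZero D]

theorem gamma_mem {n : ℕ} (i : Fin (2 * n)) : gamma D n i ∈ PF D n :=
  Subgroup.subset_closure ⟨i, rfl⟩

theorem weylComm_mode_same (j : Fin m) {r s : Fin 4} (hrs : r < s) :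
    WeylComm (omega D (2 * m)) (gamma D (2 * m) (mode j r)) (gamma D (2 * m) (mode j s))
      (1 : ZMod D) :=
  weylComm_gamma (by rw [Fin.lt_def] at hrs ⊢; simp only [mode]; omega)

/-- The exponent depends only on the order of the two sites. Being uniform in `r` and `s`, it makes
exponents between sites proportional to products of charges. -/
theorem weylComm_mode_of_ne {i j : Fin m} (hij : i ≠ j) :
    ∃ t : ZMod D, ∀ r s, WeylComm (omega D (2 * m)) (gamma D (2 * m) (mode i r))
      (gamma D (2 * m) (mode j s)) t := by
  rcases lt_or_gt_of_ne hij with h | h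
  · exact ⟨1, fun r s => weylComm_gamma (by rw [Fin.lt_def] at h ⊢; simp only [mode]; omega)⟩
  · exact ⟨-1, fun r s => isPhase_omega.weylComm_symm (weylComm_gamma (by
      rw [Fin.lt_def] at h ⊢; simp only [mode]; omega))⟩

/-- The commutation phases of the mode `r` of a site with the four modes of that site. -/
theorem weylComm_mode_table (j : Fin m) (r s : Fin 4) :
    WeylComm (omega D (2 * m)) (gamma D (2 * m) (mode j r)) (gamma D (2 * m) (mode j s))
      (if r < s then 1 else if s < r then -1 else 0 : ZMod D) := by
  split_ifs with h1 h2
  · exact weylComm_mode_same j h1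
  · exact isPhase_omega.weylComm_symm (weylComm_mode_same j h2)
  · rw [le_antisymm (not_lt.1 h2) (not_lt.1 h1)]
    exact isPhase_omega.weylComm_of_commute (Commute.refl _)

theorem siteZ_mem (j : Fin m) : siteZ D q j ∈ PF D (2 * m) :=
  mul_mem (pow_mem (gamma_mem _) _) (gamma_mem _)

theorem siteX_mem (j : Fin m) : siteX D q j ∈ PF D (2 * m) :=
  mul_mem (pow_mem (gamma_mem _) _) (gamma_mem _)

theorem siteQ_mem (j : Fin m) : siteQ D q j ∈ PF D (2 * m) :=
  mul_mem (mul_mem (mul_mem (inv_mem (gamma_mem _)) (pow_mem (gamma_mem _) _))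
    (pow_mem (inv_mem (gamma_mem _)) _)) (gamma_mem _)

variable {V : Op D (2 * m)} {s : Fin 4 → ZMod D} {j : Fin m}

/-- By additivity, the exponent with a product of modes is the corresponding linear form in the
exponents `s r`. The same holds for `siteX` and `siteQ`, so later commutations become polynomial
identities in `q`. -/
theorem weylComm_siteZ (hq : 0 < q)
    (hV : ∀ r, WeylComm (omega D (2 * m)) V (gamma D (2 * m) (mode j r)) (s r)) :
    WeylComm (omega D (2 * m)) V (siteZ D q j) (((q : ZMod D) - 1) * s 0 + s 1) := by
  have hω := isPhase_omega (D := D) (n := 2 * m)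
  have := hω.weylComm_mul_right (hω.weylComm_pow_right (hV 0) (q - 1)) (hV 1)
  rwa [Nat.cast_sub hq, Nat.cast_one] at this

theorem weylComm_siteX (hq : 0 < q)
    (hV : ∀ r, WeylComm (omega D (2 * m)) V (gamma D (2 * m) (mode j r)) (s r)) :
    WeylComm (omega D (2 * m)) V (siteX D q j) (((q : ZMod D) - 1) * s 0 + s 2) := by
  have hω := isPhase_omega (D := D) (n := 2 * m)
  have := hω.weylComm_mul_right (hω.weylComm_pow_right (hV 0) (q - 1)) (hV 2)
  rwa [Nat.cast_sub hq, Nat.cast_one] at this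

theorem weylComm_siteQ
    (hV : ∀ r, WeylComm (omega D (2 * m)) V (gamma D (2 * m) (mode j r)) (s r)) :
    WeylComm (omega D (2 * m)) V (siteQ D q j)
      (-s 0 + ((q : ZMod D) + 1) * s 1 - ((q : ZMod D) + 1) * s 2 + s 3) := by
  have hω := isPhase_omega (D := D) (n := 2 * m)
  have := hω.weylComm_mul_right (hω.weylComm_mul_right (hω.weylComm_mul_right
    (hω.weylComm_inv_right (hV 0)) (hω.weylComm_pow_right (hV 1) (q + 1)))
    (hω.weylComm_pow_right (hω.weylComm_inv_right (hV 2)) (q + 1))) (hV 3)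
  have h1 : -s 0 + ((q : ZMod D) + 1) * s 1 - ((q : ZMod D) + 1) * s 2 + s 3 =
      -s 0 + ((q + 1 : ℕ) : ZMod D) * s 1 + ((q + 1 : ℕ) : ZMod D) * -s 2 + s 3 := by
    push_cast
    ring
  rw [h1]
  exact this

theorem weylComm_mode_siteZ (hq : 0 < q) (r : Fin 4) :
    WeylComm (omega D (2 * m)) (gamma D (2 * m) (mode j r)) (siteZ D q j)
      ((![1, 1 - q, -q, -q] : Fin 4 → ZMod D) r) := by
  convert weylComm_siteZ hq (weylComm_mode_table j r) using 1
  fin_cases r <;> simp <;> ring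

theorem weylComm_mode_siteX (hq : 0 < q) (r : Fin 4) :
    WeylComm (omega D (2 * m)) (gamma D (2 * m) (mode j r)) (siteX D q j)
      ((![1, 2 - q, 1 - q, -q] : Fin 4 → ZMod D) r) := by
  convert weylComm_siteX hq (weylComm_mode_table j r) using 1
  fin_cases r <;> simp <;> ring

theorem weylComm_mode_siteQ (r : Fin 4) :
    WeylComm (omega D (2 * m)) (gamma D (2 * m) (mode j r)) (siteQ D q j)
      ((![1, 1 - q, 1 - q, 1] : Fin 4 → ZMod D) r) := by
  convert weylComm_siteQ (weylComm_mode_table j r) using 1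
  fin_cases r <;> simp <;> ring

variable (j)

theorem weylComm_siteZ_siteX_same (hq : 0 < q) :
    WeylComm (omega D (2 * m)) (siteZ D q j) (siteX D q j) (1 : ZMod D) := by
  have hω := isPhase_omega (D := D) (n := 2 * m)
  convert weylComm_siteX hq (fun r => hω.weylComm_symm (weylComm_mode_siteZ (j := j) hq r)) using 1
  simp

theorem commute_siteZ_siteQ_same (hq : 0 < q) :
    Commute (siteZ D q j) (siteQ D q j) := by
  have hω := isPhase_omega (D := D) (n := 2 * m)
  rw [← hω.weylComm_zero_iff]
  convert weylComm_siteQ (q := q)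
    (fun r => hω.weylComm_symm (weylComm_mode_siteZ (j := j) hq r)) using 1
  simp
  ring

theorem commute_siteX_siteQ_same (hq : 0 < q) :
    Commute (siteX D q j) (siteQ D q j) := by
  have hω := isPhase_omega (D := D) (n := 2 * m)
  rw [← hω.weylComm_zero_iff]
  convert weylComm_siteQ (q := q)
    (fun r => hω.weylComm_symm (weylComm_mode_siteX (j := j) hq r)) using 1
  simp
  ring

variable {j}

/-- Operators at different sites commute up to the product of their charges. -/
theorem exists_weylComm_sites_of_ne {i : Fin m} (hq : 0 < q) (hq2 : (q : ZMod D) ^ 2 = 0)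
    (hij : i ≠ j) :
    Commute (siteX D q i) (siteX D q j) ∧ Commute (siteZ D q i) (siteZ D q j) ∧
      Commute (siteQ D q i) (siteQ D q j) ∧ Commute (siteX D q i) (siteQ D q j) ∧
      Commute (siteZ D q i) (siteQ D q j) ∧ Commute (siteZ D q i) (siteX D q j) ∧
      Commute (gamma D (2 * m) (mode i 0)) (siteQ D q j) ∧
      (∃ t : ZMod D, WeylComm (omega D (2 * m)) (gamma D (2 * m) (mode i 0)) (siteX D q j) t) ∧
      ∃ t : ZMod D, WeylComm (omega D (2 * m)) (gamma D (2 * m) (mode i 0)) (siteZ D q j) t := by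
  have hω := isPhase_omega (D := D) (n := 2 * m)
  obtain ⟨t, ht⟩ := weylComm_mode_of_ne (D := D) hij
  have hX := fun r => weylComm_siteX hq (ht r)
  have hZ := fun r => weylComm_siteZ hq (ht r)
  -- The charge of `siteQ` is `-1 + (q + 1) - (q + 1) + 1 = 0`, so `t` drops out.
  have hQ : ∀ r, WeylComm (omega D (2 * m)) (gamma D (2 * m) (mode i r)) (siteQ D q j)
      (0 : ZMod D) := fun r => by
    convert weylComm_siteQ (q := q) (ht r) using 1
    ring
  have hX' := fun r => hω.weylComm_symm (hX r)
  have hZ' := fun r => hω.weylComm_symm (hZ r)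
  have hQ' := fun r => hω.weylComm_symm (hQ r)
  refine ⟨?_, ?_, ?_, ?_, ?_, ?_, hω.weylComm_zero_iff.1 (hQ 0), ⟨_, hX 0⟩, ⟨_, hZ 0⟩⟩
  · refine Commute.symm (hω.weylComm_zero_iff.1 ?_)
    convert weylComm_siteX hq hX' using 1
    -- Two operators of charge `q` leave the exponent `-t * q ^ 2`, which is zero modulo `D`.
    linear_combination t * hq2
  · refine Commute.symm (hω.weylComm_zero_iff.1 ?_)
    convert weylComm_siteZ hq hZ' using 1
    linear_combination t * hq2
  · refine Commute.symm (hω.weylComm_zero_iff.1 ?_)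
    convert weylComm_siteQ (q := q) hQ' using 1
    ring
  · refine Commute.symm (hω.weylComm_zero_iff.1 ?_)
    convert weylComm_siteX hq hQ' using 1
    ring
  · refine Commute.symm (hω.weylComm_zero_iff.1 ?_)
    convert weylComm_siteZ hq hQ' using 1
    ring
  · refine Commute.symm (hω.weylComm_zero_iff.1 ?_)
    convert weylComm_siteZ hq hX' using 1
    linear_combination t * hq2

theorem choose_two_mul_two : ((D.choose 2 : ℕ) : ZMod D) * 2 = 0 := by
  have h1 : D.choose 2 * 2 = D * (D - 1) := by
    rw [Nat.choose_two_right, Nat.div_mul_cancel (Nat.even_mul_pred_self D).two_dvd]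
  have h2 := congrArg (Nat.cast : ℕ → ZMod D) h1
  push_cast at h2
  rw [h2, ZMod.natCast_self, zero_mul]

theorem gamma_pow_pow_dim {n : ℕ} (i : Fin (2 * n)) (k : ℕ) : (gamma D n i ^ k) ^ D = 1 := by
  rw [← pow_mul, mul_comm k, pow_mul, gamma_pow_dim, one_pow]

theorem gamma_inv_pow_pow_dim {n : ℕ} (i : Fin (2 * n)) (k : ℕ) :
    ((gamma D n i)⁻¹ ^ k) ^ D = 1 := by
  rw [inv_pow, inv_pow, gamma_pow_pow_dim, inv_one]

/-- The two factors have exponent `q - 1` with each other, and reordering multiplies it by `D choose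
2`. The power `q - 1` of the half phase cancels the result, which explains the `η` of `siteSystem`.
-/
theorem siteZ_pow_dim (hq : 0 < q) (j : Fin m) :
    siteZ D q j ^ D = phase (omega D (2 * m)) (-(((q : ZMod D) - 1) * (D.choose 2 : ZMod D))) := by
  have hω := isPhase_omega (D := D) (n := 2 * m)
  have h1 := hω.weylComm_pow_left (weylComm_mode_same (D := D) j (r := 0) (s := 1) (by decide))
    (q - 1)
  rw [siteZ, hω.mul_pow_of_weylComm h1, gamma_pow_pow_dim, gamma_pow_dim, mul_one, mul_one,
    Nat.cast_sub hq, Nat.cast_one, mul_one]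

theorem siteX_pow_dim (hq : 0 < q) (j : Fin m) :
    siteX D q j ^ D = phase (omega D (2 * m)) (-(((q : ZMod D) - 1) * (D.choose 2 : ZMod D))) := by
  have hω := isPhase_omega (D := D) (n := 2 * m)
  have h1 := hω.weylComm_pow_left (weylComm_mode_same (D := D) j (r := 0) (s := 2) (by decide))
    (q - 1)
  rw [siteX, hω.mul_pow_of_weylComm h1, gamma_pow_pow_dim, gamma_pow_dim, mul_one, mul_one,
    Nat.cast_sub hq, Nat.cast_one, mul_one]

/-- Reordering multiplies `D choose 2` by the sum of the exponents of the six pairs of factors,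
which is `-(q ^ 2 + 2 (q + 1))`. The first term vanishes modulo `D`, and `2` annihilates `D choose
2`. Hence `Q̃` needs no phase correction. -/
theorem siteQ_pow_dim (hq2 : (q : ZMod D) ^ 2 = 0) (j : Fin m) : siteQ D q j ^ D = 1 := by
  have hω := isPhase_omega (D := D) (n := 2 * m)
  have hg : ∀ {r s : Fin 4}, r < s → _ := fun h => weylComm_mode_same (D := D) j h
  have h01 := hω.weylComm_inv_left (hω.weylComm_pow_right (hg (r := 0) (s := 1) (by decide)) (q + 1))
  have h02 := hω.weylComm_inv_left (hω.weylComm_pow_right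
    (hω.weylComm_inv_right (hg (r := 0) (s := 2) (by decide))) (q + 1))
  have h12 := hω.weylComm_pow_left (hω.weylComm_pow_right
    (hω.weylComm_inv_right (hg (r := 1) (s := 2) (by decide))) (q + 1)) (q + 1)
  have h03 := hω.weylComm_inv_left (hg (r := 0) (s := 3) (by decide))
  have h13 := hω.weylComm_pow_left (hg (r := 1) (s := 3) (by decide)) (q + 1)
  have h23 := hω.weylComm_pow_left (hω.weylComm_inv_left (hg (r := 2) (s := 3) (by decide))) (q + 1)
  rw [siteQ, hω.mul_pow_of_weylComm
      (hω.weylComm_mul_left (hω.weylComm_mul_left h03 h13) h23),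
    hω.mul_pow_of_weylComm (hω.weylComm_mul_left h02 h12), hω.mul_pow_of_weylComm h01, gamma_pow_pow_dim,
    gamma_inv_pow_pow_dim, gamma_pow_dim, inv_pow, gamma_pow_dim, inv_one]
  simp only [mul_one]
  rw [
    ← hω.phase_add, ← hω.phase_add, hω.phase_eq_one_iff]
  push_cast
  linear_combination (D.choose 2 : ZMod D) * hq2 + (q + 1) * choose_two_mul_two (D := D)

theorem weylComm_siteX_charge (hq : 0 < q) (j : Fin m) :
    WeylComm (omega D (2 * m)) (siteX D q j) (shift 1) (q : ZMod D) := by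
  have hω := isPhase_omega (D := D) (n := 2 * m)
  have := hω.weylComm_symm (weylComm_siteX (j := j) hq
    fun r => hω.weylComm_symm (weylComm_gamma_charge (D := D) (mode j r)))
  convert this using 1
  ring

theorem weylComm_siteZ_charge (hq : 0 < q) (j : Fin m) :
    WeylComm (omega D (2 * m)) (siteZ D q j) (shift 1) (q : ZMod D) := by
  have hω := isPhase_omega (D := D) (n := 2 * m)
  have := hω.weylComm_symm (weylComm_siteZ (j := j) hq
    fun r => hω.weylComm_symm (weylComm_gamma_charge (D := D) (mode j r)))
  convert this using 1
  ring

theorem commute_siteQ_charge (j : Fin m) : Commute (siteQ D q j) (shift 1) := by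
  have hω := isPhase_omega (D := D) (n := 2 * m)
  have := hω.weylComm_symm (weylComm_siteQ (q := q) (j := j)
    fun r => hω.weylComm_symm (weylComm_gamma_charge (D := D) (mode j r)))
  rw [← hω.weylComm_zero_iff]
  convert this using 1
  ring

/-- The four generators are triangular in the modes: `Z̃`, `X̃`, `Q̃` end in `γ₂`, `γ₃`, `γ₄` to the
first power, so these modes can be solved for in turn. -/
theorem closure_sites_eq_PF : PF D (2 * m) = Subgroup.closure (Set.range
    (Sum.elim (Sum.elim (fun j : Fin m => gamma D (2 * m) (mode j 0)) (siteX D q))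
      (Sum.elim (siteZ D q) (siteQ D q)))) := by
  apply le_antisymm
  · rw [PF, Subgroup.closure_le]
    rintro _ ⟨i, rfl⟩
    set H := Subgroup.closure (Set.range
      (Sum.elim (Sum.elim (fun j : Fin m => gamma D (2 * m) (mode j 0)) (siteX D q))
        (Sum.elim (siteZ D q) (siteQ D q)))) with hH
    obtain ⟨j, r, rfl⟩ : ∃ (j : Fin m) (r : Fin 4), i = mode j r :=
      ⟨⟨i / 4, by omega⟩, ⟨i % 4, by omega⟩, by ext; simp only [mode]; omega⟩
    have h0 : gamma D (2 * m) (mode j 0) ∈ H := Subgroup.subset_closure ⟨.inl (.inl j), rfl⟩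
    have hX : siteX D q j ∈ H := Subgroup.subset_closure ⟨.inl (.inr j), rfl⟩
    have hZ : siteZ D q j ∈ H := Subgroup.subset_closure ⟨.inr (.inl j), rfl⟩
    have hQ : siteQ D q j ∈ H := Subgroup.subset_closure ⟨.inr (.inr j), rfl⟩
    have h1 : gamma D (2 * m) (mode j 1) ∈ H := (mul_mem_cancel_left (pow_mem h0 _)).1 hZ
    have h2 : gamma D (2 * m) (mode j 2) ∈ H := (mul_mem_cancel_left (pow_mem h0 _)).1 hX
    have h3 : gamma D (2 * m) (mode j 3) ∈ H :=
      (mul_mem_cancel_left (mul_mem (mul_mem (inv_mem h0) (pow_mem h1 _))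
        (pow_mem (inv_mem h2) _))).1 hQ
    fin_cases r
    exacts [h0, h1, h2, h3]
  · rw [Subgroup.closure_le]
    rintro _ ⟨(j | j) | (j | j), rfl⟩
    exacts [gamma_mem _, siteX_mem j, siteZ_mem j, siteQ_mem j]

/-- The first mode of each site serves as the detector `E`: its exponent with `Q̃` is `1` on its own
site and `0` on the others. -/
theorem siteSystem (hq : 0 < q) (hq2 : (q : ZMod D) ^ 2 = 0) (m : ℕ) :
    SiteSystem D (omega D (2 * m)) (halfPhase D (2 * m) ^ (q - 1)) (PF D (2 * m))
      (fun j : Fin m => gamma D (2 * m) (mode j 0)) (siteX D q) (siteZ D q) (siteQ D q) := by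
  have hω := isPhase_omega (D := D) (n := 2 * m)
  have hη : (halfPhase D (2 * m) ^ (q - 1)) ^ D =
      phase (omega D (2 * m)) (((q : ZMod D) - 1) * (D.choose 2 : ZMod D)) := by
    rw [← pow_mul, mul_comm (q - 1), pow_mul, halfPhase_pow_dim, ← hω.phase_nsmul, Nat.cast_sub hq,
      Nat.cast_one]
  have hne := fun {i j : Fin m} (hij : i ≠ j) => exists_weylComm_sites_of_ne hq hq2 hij
  exact
  { phase := hω
    η_comm := fun U => (halfPhase_comm U).pow_left _
    gen := closure_sites_eq_PF
    XX := fun i j => by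
      by_cases hij : i = j
      · rw [hij]; exact Commute.refl _
      · exact (hne hij).1
    ZZ := fun i j => by
      by_cases hij : i = j
      · rw [hij]; exact Commute.refl _
      · exact (hne hij).2.1
    QQ := fun i j => by
      by_cases hij : i = j
      · rw [hij]; exact Commute.refl _
      · exact (hne hij).2.2.1
    XQ := fun i j => by
      by_cases hij : i = j
      · rw [hij]; exact commute_siteX_siteQ_same j hq
      · exact (hne hij).2.2.2.1
    ZQ := fun i j => by
      by_cases hij : i = j
      · rw [hij]; exact commute_siteZ_siteQ_same j hq
      · exact (hne hij).2.2.2.2.1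
    ZX := fun i j => by
      split_ifs with hij
      · rw [hij]; exact weylComm_siteZ_siteX_same i hq
      · exact hω.weylComm_of_commute (hne (Ne.symm hij)).2.2.2.2.2.1
    EQ := fun i j => by
      split_ifs with hij
      · rw [hij]; exact weylComm_mode_siteQ 0
      · exact hω.weylComm_of_commute (hne (Ne.symm hij)).2.2.2.2.2.2.1
    EX := fun i j => by
      by_cases hij : i = j
      · rw [hij]; exact ⟨_, weylComm_mode_siteX hq 0⟩
      · exact (hne hij).2.2.2.2.2.2.2.1
    EZ := fun i j => by
      by_cases hij : i = j
      · rw [hij]; exact ⟨_, weylComm_mode_siteZ hq 0⟩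
      · exact (hne hij).2.2.2.2.2.2.2.2
    EE := fun i j => exists_weylComm_gamma _ _
    X_pow := fun j => by
      rw [((halfPhase_comm _).pow_left _).mul_pow, hη, siteX_pow_dim hq, ← hω.phase_add,
        add_neg_cancel, IsPhase.phase_zero]
    Z_pow := fun j => by
      rw [((halfPhase_comm _).pow_left _).mul_pow, hη, siteZ_pow_dim hq, ← hω.phase_add,
        add_neg_cancel, IsPhase.phase_zero]
    Q_pow := siteQ_pow_dim hq2
    E_pow := fun j => gamma_pow_dim _
    X_pow_mem := fun j => hω.mem_zpowers_iff.2 ⟨_, siteX_pow_dim hq j⟩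
    Z_pow_mem := fun j => hω.mem_zpowers_iff.2 ⟨_, siteZ_pow_dim hq j⟩ }

end Sites

/-! ### Stabilizer groups of words -/

section Encoding

variable {D n : ℕ} [NeZero D] {ι : Type*} [Fintype ι] [DecidableEq ι] {η : Op D n}
  {E X Z Q : ι → Op D n} (h : SiteSystem D (omega D n) η (PF D n) E X Z Q)
  {LX LZ LQ : AddSubgroup (ι → ZMod D)} {ho : ∀ x ∈ LX, ∀ z ∈ LZ, z ⬝ᵥ x = 0}
include h

theorem isStabilizer_wordGroup (hPF : h.wordGroup LX LZ LQ ho ≤ PF D n)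
    (hc : ∀ W ∈ h.wordGroup LX LZ LQ ho, Commute W (shift 1)) :
    IsStabilizer (h.wordGroup LX LZ LQ ho) where
  le_PF := hPF
  parity W hW := hasParity_of_mem (hPF hW) (isPhase_omega.weylComm_of_commute (hc W hW))
  abelian _ hU _ hV := h.wordGroup_commute hU hV
  no_scalar _ hj := h.eq_one_of_mem_wordGroup hj

theorem finrank_codeSpace_wordGroup :
    Module.finrank ℂ (codeSpace (h.wordGroup LX LZ LQ ho)) *
      (Nat.card LX * (Nat.card LZ * Nat.card LQ)) = D ^ n := by
  have := h.finite_wordGroup (LX := LX) (LZ := LZ) (LQ := LQ) (ho := ho)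
  rw [← h.card_wordGroup (ho := ho)]
  exact finrank_codeSpace_mul_card _ fun W hW hne => h.exists_weylComm_of_mem_wordGroup hW hne

/-- Turns linear algebra over `ZMod D` into an encoding. The vectors `ξ`, `ζ` are dual bases of the
two complements modulo `LX` and `LZ`; `r` and `s` count the factors `η` by which the logical
operators differ from normalized words. -/
theorem encodesQudits_wordGroup {t₀ : ℕ} (hη : η = halfPhase D n ^ t₀) (hD : 1 < D)
    (hS : IsStabilizer (h.wordGroup LX LZ ⊤ ho)) {k : ℕ} (hk : 0 < k)
    (hcard : D ^ k * (Nat.card LX * (Nat.card LZ * D ^ Fintype.card ι)) = D ^ n)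
    {XL ZL : Fin k → Op D n} (hXL : ∀ i, XL i ∈ PF D n) (hZL : ∀ i, ZL i ∈ PF D n)
    {ξ ζ : Fin k → ι → ZMod D} {r s : Fin k → ℕ}
    (hξ : ∀ i, η ^ r i * XL i = h.homX (.ofAdd (ξ i)))
    (hζ : ∀ i, η ^ s i * ZL i = h.homZ (.ofAdd (ζ i)))
    (hξo : ∀ i, ∀ z ∈ LZ, z ⬝ᵥ ξ i = 0) (hζo : ∀ i, ∀ x ∈ LX, ζ i ⬝ᵥ x = 0)
    (hζξ : ∀ i j, ζ i ⬝ᵥ ξ j = if i = j then 1 else 0)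
    (hX : ∀ x, (∀ z ∈ LZ, z ⬝ᵥ x = 0) →
      ∃ x₀ ∈ LX, ∃ a : Fin k → ZMod D, x = x₀ + ∑ i, a i • ξ i)
    (hZ : ∀ z, (∀ x ∈ LX, z ⬝ᵥ x = 0) →
      ∃ z₀ ∈ LZ, ∃ a : Fin k → ZMod D, z = z₀ + ∑ i, a i • ζ i) :
    EncodesQudits (h.wordGroup LX LZ ⊤ ho) k XL ZL := by
  have hω := isPhase_omega (D := D) (n := n)
  have : Fact (1 < D) := ⟨hD⟩
  have hc : ∀ (t : ℕ) (U : Op D n), Commute (η ^ t) U := fun t U => (h.η_comm U).pow_left t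
  have hξ' : ∀ i, XL i = (η ^ r i)⁻¹ * h.homX (.ofAdd (ξ i)) := fun i => by
    rw [← hξ, inv_mul_cancel_left]
  have hζ' : ∀ i, ZL i = (η ^ s i)⁻¹ * h.homZ (.ofAdd (ζ i)) := fun i => by
    rw [← hζ, inv_mul_cancel_left]
  have hXc : ∀ {i} {U : Op D n}, Commute (h.homX (.ofAdd (ξ i))) U → Commute (XL i) U :=
    fun hU => by rw [hξ']; exact ((hc _ _).inv_left).mul_left hU
  have hZc : ∀ {i} {U : Op D n}, Commute (h.homZ (.ofAdd (ζ i))) U → Commute (ZL i) U :=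
    fun hU => by rw [hζ']; exact ((hc _ _).inv_left).mul_left hU
  have hZX : ∀ i j, WeylComm (omega D n) (ZL i) (XL j) (if i = j then 1 else 0 : ZMod D) := by
    intro i j
    have h1 := h.weylComm_homZ_homX (ξ j) (ζ i)
    rw [hζξ] at h1
    rw [hζ', hξ']
    simpa using hω.weylComm_mul_left (hω.weylComm_of_commute ((hc (s i) _).inv_left))
      (hω.weylComm_mul_right (hω.weylComm_of_commute ((hc (r j) _).inv_left).symm) h1)
  have hXS : ∀ i, ∀ W ∈ h.wordGroup LX LZ ⊤ ho, Commute W (XL i) := by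
    rintro i _ ⟨x, hx, z, hz, w, hw, rfl⟩
    refine (hXc (Commute.mul_right (Commute.mul_right ?_ ?_) ?_)).symm
    · exact h.commute_homX (h.commute_homX_X _) _
    · rw [← hω.weylComm_zero_iff, ← neg_zero, ← hξo i z hz]
      exact h.weylComm_homX_homZ _ _
    · exact h.commute_homQ (h.commute_homX_Q _) _
  have hZS : ∀ i, ∀ W ∈ h.wordGroup LX LZ ⊤ ho, Commute W (ZL i) := by
    rintro i _ ⟨x, hx, z, hz, w, hw, rfl⟩
    refine (hZc (Commute.mul_right (Commute.mul_right ?_ ?_) ?_)).symm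
    · rw [← hω.weylComm_zero_iff, ← hζo i x hx]
      exact h.weylComm_homZ_homX _ _
    · exact h.commute_homZ (h.commute_homZ_Z _) _
    · exact h.commute_homQ (h.commute_homZ_Q _) _
  -- A logical operator inside the stabilizer would commute with its partner; here `1 < D` makes `ω`
  -- nontrivial.
  have hnot : ∀ i, ¬ Commute (ZL i) (XL i) := fun i hi => by
    have := hZX i i
    rw [if_pos rfl] at this
    exact one_ne_zero ((hω.weylComm_commute this).1 hi)
  have hweyl : ∀ i, ZL i * XL i = omega D n * (XL i * ZL i) := fun i => by
    have := hZX i i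
    rw [if_pos rfl, ← Nat.cast_one, WeylComm, hω.phase_natCast, pow_one] at this
    exact this
  refine
    { stabilizer := hS
      dim_codeSpace := ?_
      X_logical := fun i => ⟨Subgroup.mem_inf.2 ⟨hXL i, Subgroup.mem_centralizer_iff.2
        fun W hW => hXS i W hW⟩, fun hi => hnot i (hZS i _ hi).symm⟩
      Z_logical := fun i => ⟨Subgroup.mem_inf.2 ⟨hZL i, Subgroup.mem_centralizer_iff.2
        fun W hW => hZS i W hW⟩, fun hi => hnot i (hXS i _ hi)⟩
      weyl := hweyl
      X_pow := fun i => ⟨t₀ * r i, ?_⟩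
      Z_pow := fun i => ⟨t₀ * s i, ?_⟩
      XX_comm := fun i j => hXc (hXc (h.commute_homX (h.commute_homX_X _) _)).symm
      ZZ_comm := fun i j => hZc (hZc (h.commute_homZ (h.commute_homZ_Z _) _)).symm
      ZX_comm := fun i j hij => ?_
      centralizer_eq := ?_ }
  · have h1 := finrank_codeSpace_wordGroup h (LX := LX) (LZ := LZ) (LQ := ⊤) (ho := ho)
    rw [AddSubgroup.card_top, Nat.card_eq_fintype_card (α := ι → ZMod D), Fintype.card_fun,
      ZMod.card, ← hcard] at h1
    refine Nat.eq_of_mul_eq_mul_right ?_ h1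
    exact Nat.mul_pos Nat.card_pos (Nat.mul_pos Nat.card_pos (pow_pos (by omega) _))
  · rw [pow_mul, ← hη, hξ, ← map_pow, ← ofAdd_nsmul]
    have : D • ξ i = 0 := by ext; simp
    rw [this]; simp
  · rw [pow_mul, ← hη, hζ, ← map_pow, ← ofAdd_nsmul]
    have : D • ζ i = 0 := by ext; simp
    rw [this]; simp
  · have := hZX i j
    rwa [if_neg hij, hω.weylComm_zero_iff] at this
  · set H := Subgroup.closure ((h.wordGroup LX LZ ⊤ ho : Set (Op D n)) ∪ Set.range XL ∪
      Set.range ZL) with hH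
    have hSH : h.wordGroup LX LZ ⊤ ho ≤ H := fun W hW =>
      Subgroup.subset_closure (.inl (.inl hW))
    have hXH : ∀ i, XL i ∈ H := fun i => Subgroup.subset_closure (.inl (.inr ⟨i, rfl⟩))
    have hZH : ∀ i, ZL i ∈ H := fun i => Subgroup.subset_closure (.inr ⟨i, rfl⟩)
    have hHΓ : H ≤ PF D n := by
      rw [hH, Subgroup.closure_le]
      rintro _ ((hW | ⟨i, rfl⟩) | ⟨i, rfl⟩)
      exacts [hS.le_PF hW, hXL i, hZL i]
    apply le_antisymm
    · intro W hW
      obtain ⟨hW1, hW2⟩ := Subgroup.mem_inf.1 hW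
      refine h.mem_of_commute_wordGroup hHΓ ?_ hSH (fun x hx => ?_) (fun z hz => ?_) hW1
        fun V hV => Subgroup.mem_centralizer_iff.1 hW2 V hV
      -- The scalar `ω` belongs to the generated group as a commutator of a logical pair, which is
      -- why at least one pair is required.
      · have h1 := hweyl ⟨0, hk⟩
        rw [← mul_inv_eq_iff_eq_mul] at h1
        rw [← h1]
        exact mul_mem (mul_mem (hZH _) (hXH _)) (inv_mem (mul_mem (hXH _) (hZH _)))
      · refine h.exists_central_mul_mem h.homX
          (fun x hx => hSH (h.homX_mem_wordGroup hx)) (fun i => ⟨(η ^ r i)⁻¹, ?_, ?_⟩) (hX x hx)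
        · exact fun g => (hc _ g).inv_left
        · rw [← hξ']; exact hXH i
      · refine h.exists_central_mul_mem h.homZ
          (fun x hx => hSH (h.homZ_mem_wordGroup hx)) (fun i => ⟨(η ^ s i)⁻¹, ?_, ?_⟩) (hZ z hz)
        · exact fun g => (hc _ g).inv_left
        · rw [← hζ']; exact hZH i
    · refine le_inf hHΓ ?_
      rw [hH, Subgroup.closure_le]
      rintro _ ((hW | ⟨i, rfl⟩) | ⟨i, rfl⟩)
      · exact Subgroup.mem_centralizer_iff.2 fun V hV => h.wordGroup_commute hV hW
      · exact Subgroup.mem_centralizer_iff.2 fun V hV => hXS i V hV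
      · exact Subgroup.mem_centralizer_iff.2 fun V hV => hZS i V hV

end Encoding

end Parafermion

namespace Parafermion

set_option linter.unusedSectionVars false

/-! ### Functions on cyclic groups and on the discrete torus -/

section Cyclic

variable {K : Type*} [CommRing K] {a b : ℕ} [NeZero a] [NeZero b]

theorem eq_of_add_one_eq {α : Type*} {f : ZMod a → α} (hf : ∀ x, f (x + 1) = f x) (x : ZMod a) :
    f x = f 0 := by
  have h1 : ∀ k : ℕ, f k = f 0 := by
    intro k
    induction k with
    | zero => simp
    | succ k ih => rw [Nat.cast_succ, hf, ih]
  rw [← ZMod.natCast_zmod_val x, h1]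

theorem sum_zmod_eq_sum_fin {M : Type*} [AddCommMonoid M] (f : ZMod a → M) :
    ∑ i : Fin a, f ((i : ℕ) : ZMod a) = ∑ x, f x := by
  refine Fintype.sum_bijective (fun i : Fin a => ((i : ℕ) : ZMod a)) ?_ _ _ fun _ => rfl
  refine ⟨fun i j hij => ?_, fun x => ⟨⟨x.val, ZMod.val_lt x⟩, by simp⟩⟩
  have h1 := congrArg ZMod.val hij
  simp only [ZMod.val_natCast, Nat.mod_eq_of_lt i.2, Nat.mod_eq_of_lt j.2] at h1
  exact Fin.ext h1

/-- A function on a cyclic group with sum zero is a difference. -/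
theorem exists_sub_eq_of_sum_eq_zero (F : ZMod a → K) (hF : ∑ x, F x = 0) :
    ∃ g : ZMod a → K, ∀ x, F x = g x - g (x - 1) := by
  refine ⟨fun x => ∑ i ∈ Finset.range (x.val + 1), F i, fun x => ?_⟩
  have h0 : ∑ i ∈ Finset.range a, F i = 0 := by
    rw [← hF, ← sum_zmod_eq_sum_fin, Finset.sum_range]
  -- At `x = 0` the predecessor is represented by `a - 1`; its partial sum runs over the whole cycle
  -- and is zero by hypothesis.
  by_cases hx : x = 0
  · subst hx
    have h1 : (0 - 1 : ZMod a).val + 1 = a := by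
      rw [zero_sub]
      obtain ⟨n, rfl⟩ := Nat.exists_eq_succ_of_ne_zero (NeZero.ne a)
      rw [ZMod.val_neg_one]
    simp only
    rw [h1, h0]
    simp
  · have h1 : (x - 1).val + 1 = x.val := by
      have h2 : 0 < x.val := Nat.pos_of_ne_zero fun h => hx ((ZMod.val_eq_zero x).1 h)
      have h3 : x - 1 = ((x.val - 1 : ℕ) : ZMod a) := by
        rw [Nat.cast_sub h2, ZMod.natCast_zmod_val, Nat.cast_one]
      rw [h3, ZMod.val_natCast, Nat.mod_eq_of_lt (lt_of_le_of_lt (Nat.sub_le _ _) (ZMod.val_lt x))]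
      omega
    simp only
    rw [Finset.sum_range_succ, h1, add_sub_cancel_left, ZMod.natCast_zmod_val]

/-- The first homology of the discrete torus: closed pairs of functions are exact up to multiples
of the indicators of a row and of a column. -/
theorem exists_potential (u v : ZMod a × ZMod b → K)
    (huv : ∀ x y, u (x, y) - u (x - 1, y) = v (x, y) - v (x, y - 1)) (x₀ : ZMod a) (y₀ : ZMod b) :
    ∃ (f : ZMod a × ZMod b → K) (α β : K),
      (∀ x y, u (x, y) = f (x, y) - f (x, y - 1) + α * if y = y₀ then 1 else 0) ∧
      ∀ x y, v (x, y) = f (x, y) - f (x - 1, y) + β * if x = x₀ then 1 else 0 := by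
  -- By `huv`, neighbouring sums differ by a sum of differences of `v` around a cycle, which
  -- telescopes to zero.
  have hα : ∀ x, ∑ y, u (x, y) = ∑ y, u (0, y) := by
    refine eq_of_add_one_eq fun x => ?_
    rw [← sub_eq_zero, ← Finset.sum_sub_distrib]
    have h1 : ∀ y, u (x + 1, y) - u (x, y) = v (x + 1, y) - v (x + 1, y - 1) := fun y => by
      rw [← huv, add_sub_cancel_right]
    simp_rw [h1]
    rw [Finset.sum_sub_distrib, sub_eq_zero]
    exact (Equiv.sum_comp (Equiv.subRight (1 : ZMod b)) fun y => v (x + 1, y)).symm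
  set α := ∑ y, u (0, y) with hαd
  -- Subtracting the winding `α` at `y₀` makes the sum over `y` zero, so a potential exists for each
  -- `x` separately.
  have hG : ∀ x, ∃ g : ZMod b → K, ∀ y,
      u (x, y) - α * (if y = y₀ then 1 else 0) = g y - g (y - 1) := fun x =>
    exists_sub_eq_of_sum_eq_zero _ (by simp [Finset.sum_sub_distrib, hα])
  choose G hG using hG
  -- What these potentials leave of `v` depends on `x` alone. The same argument in the `x`
  -- direction, with winding `β`, then corrects `G` by a function `c` of `x`.
  have hr : ∀ x y, v (x, y) - (G x y - G (x - 1) y) = v (x, 0) - (G x 0 - G (x - 1) 0) := by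
    intro x
    refine eq_of_add_one_eq fun y => ?_
    have h1 := huv x (y + 1)
    have h2 := hG x (y + 1)
    have h3 := hG (x - 1) (y + 1)
    rw [add_sub_cancel_right] at h1 h2 h3
    linear_combination h2 - h3 - h1
  set β := ∑ x, (v (x, 0) - (G x 0 - G (x - 1) 0)) with hβ
  obtain ⟨c, hc⟩ := exists_sub_eq_of_sum_eq_zero
    (fun x => v (x, 0) - (G x 0 - G (x - 1) 0) - β * if x = x₀ then 1 else 0)
    (by rw [Finset.sum_sub_distrib, ← hβ]; simp)
  refine ⟨fun w => c w.1 + G w.1 w.2, α, β, fun x y => ?_, fun x y => ?_⟩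
  · linear_combination hG x y
  · linear_combination hc x + hr x y

end Cyclic

/-! ### Boundaries and coboundaries on the torus -/

section Lattice

variable {a b : ℕ}

/-- The edges are the pairs of a direction and a vertex. -/
def edgeEquiv (a b : ℕ) : (ZMod a × ZMod b) ⊕ (ZMod a × ZMod b) ≃ Edge a b where
  toFun := Sum.elim (fun v => .horizontal v.1 v.2) (fun v => .vertical v.1 v.2)
  invFun
    | .horizontal x y => .inl (x, y)
    | .vertical x y => .inr (x, y)
  left_inv := by rintro (v | v) <;> rfl
  right_inv := by rintro (_ | _) <;> rfl

instance : DecidableEq (Edge a b) := fun s t =>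
  decidable_of_iff ((edgeEquiv a b).symm s = (edgeEquiv a b).symm t) (Equiv.apply_eq_iff_eq _)

variable [NeZero a] [NeZero b]

instance : Fintype (Edge a b) := Fintype.ofEquiv _ (edgeEquiv a b)

theorem card_edge : Fintype.card (Edge a b) = 2 * (a * b) := by
  rw [← Fintype.card_congr (edgeEquiv a b), Fintype.card_sum, Fintype.card_prod, ZMod.card,
    ZMod.card, two_mul]

theorem sum_edge {M : Type*} [AddCommMonoid M] (f : Edge a b → M) :
    ∑ s, f s = ∑ x, ∑ y, f (.horizontal x y) + ∑ x, ∑ y, f (.vertical x y) := by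
  rw [← Equiv.sum_comp (edgeEquiv a b), Fintype.sum_sum_type, Fintype.sum_prod_type,
    Fintype.sum_prod_type]
  rfl

variable {D : ℕ} (ε : ℤˣ)

/-- The exponents of `∏ v, star v ^ f v`. -/
def starHom : (ZMod a × ZMod b → ZMod D) →+ (Edge a b → ZMod D) where
  toFun f
    | .horizontal x y => f (x, y) - f (x + 1, y)
    | .vertical x y => ((ε : ℤ) : ZMod D) * (f (x, y) - f (x, y + 1))
  map_zero' := by ext (_ | _) <;> simp
  map_add' f g := by ext (_ | _) <;> simp <;> ring

/-- The exponents of `∏ v, plaquette v ^ f v`. -/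
def plaquetteHom : (ZMod a × ZMod b → ZMod D) →+ (Edge a b → ZMod D) where
  toFun f
    | .horizontal x y => f (x, y) - f (x, y - 1)
    | .vertical x y => ((ε : ℤ) : ZMod D) * (f (x - 1, y) - f (x, y))
  map_zero' := by ext (_ | _) <;> simp
  map_add' f g := by ext (_ | _) <;> simp <;> ring

theorem starHom_single (v : ZMod a × ZMod b) :
    starHom ε (Pi.single v (1 : ZMod D)) =
      Pi.single (.horizontal v.1 v.2) 1 + -Pi.single (.horizontal (v.1 - 1) v.2) 1 +
        (ε : ℤ) • Pi.single (.vertical v.1 v.2) 1 +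
        (-(ε : ℤ)) • Pi.single (.vertical v.1 (v.2 - 1)) 1 := by
  obtain ⟨x, y⟩ := v
  ext (⟨x', y'⟩ | ⟨x', y'⟩)
  · simp [starHom, Pi.single_apply, eq_sub_iff_add_eq]
    ring
  · simp [starHom, Pi.single_apply, eq_sub_iff_add_eq, mul_sub]
    ring

theorem plaquetteHom_single (v : ZMod a × ZMod b) :
    plaquetteHom ε (Pi.single v (1 : ZMod D)) =
      Pi.single (.horizontal v.1 v.2) 1 + -Pi.single (.horizontal v.1 (v.2 + 1)) 1 +
        (ε : ℤ) • Pi.single (.vertical (v.1 + 1) v.2) 1 +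
        (-(ε : ℤ)) • Pi.single (.vertical v.1 v.2) 1 := by
  obtain ⟨x, y⟩ := v
  ext (⟨x', y'⟩ | ⟨x', y'⟩)
  · simp [plaquetteHom, Pi.single_apply, sub_eq_iff_eq_add]
  · simp [plaquetteHom, Pi.single_apply, sub_eq_iff_eq_add, mul_sub]

theorem dotProduct_starHom_single (z : Edge a b → ZMod D) (v : ZMod a × ZMod b) :
    z ⬝ᵥ starHom ε (Pi.single v 1) = z (.horizontal v.1 v.2) - z (.horizontal (v.1 - 1) v.2) +
      ((ε : ℤ) : ZMod D) * (z (.vertical v.1 v.2) - z (.vertical v.1 (v.2 - 1))) := by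
  rw [starHom_single]
  simp only [dotProduct_add, dotProduct_neg, dotProduct_smul, dotProduct_single, mul_one]
  simp only [zsmul_eq_mul]
  push_cast
  ring

theorem dotProduct_plaquetteHom_single (z : Edge a b → ZMod D) (v : ZMod a × ZMod b) :
    z ⬝ᵥ plaquetteHom ε (Pi.single v 1) =
      z (.horizontal v.1 v.2) - z (.horizontal v.1 (v.2 + 1)) +
      ((ε : ℤ) : ZMod D) * (z (.vertical (v.1 + 1) v.2) - z (.vertical v.1 v.2)) := by
  rw [plaquetteHom_single]
  simp only [dotProduct_add, dotProduct_neg, dotProduct_smul, dotProduct_single, mul_one]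
  simp only [zsmul_eq_mul]
  push_cast
  ring

variable [NeZero D]

theorem dotProduct_range_eq_zero {V ι : Type*} [Fintype V] [DecidableEq V] [Fintype ι]
    (d : (V → ZMod D) →+ (ι → ZMod D)) {z : ι → ZMod D} (hz : ∀ v, z ⬝ᵥ d (Pi.single v 1) = 0) :
    ∀ x ∈ d.range, z ⬝ᵥ x = 0 := by
  rintro _ ⟨f, rfl⟩
  induction f using WeylSystem.pi_zmod_induction with
  | zero => simp
  | add f g hf hg => rw [map_add, dotProduct_add, hf, hg, add_zero]
  | single v => exact hz v

theorem units_mul_self : ((ε : ℤ) : ZMod D) * ((ε : ℤ) : ZMod D) = 1 := by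
  rw [← Int.cast_mul, ← Units.val_mul, Int.units_mul_self, Units.val_one, Int.cast_one]

/-- The boundary of a boundary vanishes: the horizontal and vertical contributions to the pairing
cancel once `ε * ε = 1`. -/
theorem plaquette_star_orthogonal :
    ∀ x ∈ (starHom ε : (ZMod a × ZMod b → ZMod D) →+ _).range,
      ∀ z ∈ (plaquetteHom ε : (ZMod a × ZMod b → ZMod D) →+ _).range, z ⬝ᵥ x = 0 := by
  rintro x hx _ ⟨g, rfl⟩
  refine dotProduct_range_eq_zero _ (fun v => ?_) x hx
  rw [dotProduct_starHom_single]
  simp only [plaquetteHom, AddMonoidHom.coe_mk, ZeroHom.coe_mk]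
  linear_combination (g (v.1 - 1, v.2) - g (v.1, v.2) - g (v.1 - 1, v.2 - 1) + g (v.1, v.2 - 1)) *
    units_mul_self (D := D) ε

/-- The kernel consists of the `D` constant functions, so the first isomorphism theorem removes one
factor `D`. -/
theorem card_range_of_ker {V ι : Type*} [Fintype V] [Nonempty V] [Finite ι]
    (d : (V → ZMod D) →+ (ι → ZMod D)) (hd : ∀ f, d f = 0 ↔ ∃ c, f = fun _ => c) :
    Nat.card d.range = D ^ (Fintype.card V - 1) := by
  have h1 : Nat.card d.ker = D := by
    refine Eq.trans ?_ (Nat.card_zmod D)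
    refine Nat.card_congr (Equiv.ofBijective (fun c : ZMod D => (⟨fun _ => c, ?_⟩ : d.ker)) ?_).symm
    · exact (hd _).2 ⟨c, rfl⟩
    · refine ⟨fun c c' hc => ?_, fun ⟨f, hf⟩ => ?_⟩
      · exact congrFun (congrArg Subtype.val hc) (Classical.arbitrary V)
      · obtain ⟨c, rfl⟩ := (hd f).1 hf
        exact ⟨c, rfl⟩
  have h2 := AddSubgroup.card_eq_card_quotient_mul_card_addSubgroup d.ker
  rw [Nat.card_congr (QuotientAddGroup.quotientKerEquivRange d).toEquiv, h1,
    Nat.card_fun, Nat.card_zmod, Nat.card_eq_fintype_card (α := V),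
    ← Nat.sub_add_cancel (Fintype.card_pos (α := V)), pow_succ] at h2
  exact (Nat.eq_of_mul_eq_mul_right (Nat.pos_of_ne_zero (NeZero.ne D)) h2).symm

theorem units_mul_eq_zero {t : ZMod D} : ((ε : ℤ) : ZMod D) * t = 0 ↔ t = 0 := by
  refine ⟨fun h => ?_, fun h => by rw [h, mul_zero]⟩
  rw [← one_mul t, ← units_mul_self ε, mul_assoc, h, mul_zero]

/-- The torus is connected: vanishing differences along all edges force `f` to be constant. -/
theorem starHom_eq_zero_iff (f : ZMod a × ZMod b → ZMod D) :
    starHom ε f = 0 ↔ ∃ c, f = fun _ => c := by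
  constructor
  · intro h
    have hx : ∀ x y, f (x + 1, y) = f (x, y) := fun x y =>
      (sub_eq_zero.1 (congrFun h (.horizontal x y))).symm
    have hy : ∀ x y, f (x, y + 1) = f (x, y) := fun x y =>
      (sub_eq_zero.1 ((units_mul_eq_zero ε).1 (congrFun h (.vertical x y)))).symm
    refine ⟨f (0, 0), funext fun v => ?_⟩
    rw [← eq_of_add_one_eq (f := fun y => f (0, y)) (hy 0) v.2]
    exact eq_of_add_one_eq (f := fun x => f (x, v.2)) (fun x => hx x v.2) v.1
  · rintro ⟨c, rfl⟩
    ext (_ | _) <;> simp [starHom]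

theorem plaquetteHom_eq_zero_iff (f : ZMod a × ZMod b → ZMod D) :
    plaquetteHom ε f = 0 ↔ ∃ c, f = fun _ => c := by
  constructor
  · intro h
    have hx : ∀ x y, f (x + 1, y) = f (x, y) := fun x y => by
      have := sub_eq_zero.1 ((units_mul_eq_zero ε).1 (congrFun h (.vertical (x + 1) y)))
      rw [add_sub_cancel_right] at this
      exact this.symm
    have hy : ∀ x y, f (x, y + 1) = f (x, y) := fun x y => by
      have := sub_eq_zero.1 (congrFun h (.horizontal x (y + 1)))
      rwa [add_sub_cancel_right] at this
    refine ⟨f (0, 0), funext fun v => ?_⟩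
    rw [← eq_of_add_one_eq (f := fun y => f (0, y)) (hy 0) v.2]
    exact eq_of_add_one_eq (f := fun x => f (x, v.2)) (fun x => hx x v.2) v.1
  · rintro ⟨c, rfl⟩
    ext (_ | _) <;> simp [plaquetteHom]

theorem card_vertex : Fintype.card (ZMod a × ZMod b) = a * b := by
  rw [Fintype.card_prod, ZMod.card, ZMod.card]

theorem card_range_starHom :
    Nat.card (starHom ε : (ZMod a × ZMod b → ZMod D) →+ _).range = D ^ (a * b - 1) := by
  rw [card_range_of_ker _ (starHom_eq_zero_iff ε), card_vertex]

theorem card_range_plaquetteHom :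
    Nat.card (plaquetteHom ε : (ZMod a × ZMod b → ZMod D) →+ _).range = D ^ (a * b - 1) := by
  rw [card_range_of_ker _ (plaquetteHom_eq_zero_iff ε), card_vertex]

variable (D)

/-- The indicators of the horizontal edges in a column and of the vertical edges in a row. -/
def loopX (x₀ : ZMod a) (y₀ : ZMod b) : Fin 2 → Edge a b → ZMod D :=
  ![fun s => match s with
      | .horizontal x _ => if x = x₀ then 1 else 0
      | .vertical _ _ => 0,
    fun s => match s with
      | .horizontal _ _ => 0
      | .vertical _ y => if y = y₀ then 1 else 0]

/-- The indicators of the horizontal edges in a row and of the vertical edges in a column. -/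
def loopZ (x₀ : ZMod a) (y₀ : ZMod b) : Fin 2 → Edge a b → ZMod D :=
  ![fun s => match s with
      | .horizontal _ y => if y = y₀ then 1 else 0
      | .vertical _ _ => 0,
    fun s => match s with
      | .horizontal _ _ => 0
      | .vertical x _ => if x = x₀ then 1 else 0]

variable {D} (x₀ : ZMod a) (y₀ : ZMod b)

theorem loopZ_dotProduct_loopX (i j : Fin 2) :
    loopZ D x₀ y₀ i ⬝ᵥ loopX D x₀ y₀ j = if i = j then 1 else 0 := by
  fin_cases i <;> fin_cases j <;> simp [dotProduct, sum_edge, loopX, loopZ]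

theorem loopX_orthogonal (i : Fin 2) :
    ∀ z ∈ (plaquetteHom ε : (ZMod a × ZMod b → ZMod D) →+ _).range,
      z ⬝ᵥ loopX D x₀ y₀ i = 0 := by
  intro z hz
  rw [dotProduct_comm]
  refine dotProduct_range_eq_zero _ (fun v => ?_) z hz
  rw [dotProduct_plaquetteHom_single]
  fin_cases i <;> simp [loopX]

theorem loopZ_orthogonal (i : Fin 2) :
    ∀ x ∈ (starHom ε : (ZMod a × ZMod b → ZMod D) →+ _).range,
      loopZ D x₀ y₀ i ⬝ᵥ x = 0 := by
  refine dotProduct_range_eq_zero _ (fun v => ?_)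
  rw [dotProduct_starHom_single]
  fin_cases i <;> simp [loopZ]

theorem exists_eq_add_loopZ (z : Edge a b → ZMod D)
    (hz : ∀ x ∈ (starHom ε : (ZMod a × ZMod b → ZMod D) →+ _).range, z ⬝ᵥ x = 0) :
    ∃ z₀ ∈ (plaquetteHom ε : (ZMod a × ZMod b → ZMod D) →+ _).range, ∃ c : Fin 2 → ZMod D,
      z = z₀ + ∑ i, c i • loopZ D x₀ y₀ i := by
  -- Orthogonality to the star at `(x, y)` is the closedness condition once the vertical part is
  -- scaled by `-ε`. Multiplying by `-ε` again undoes the scaling, whence the coefficient of the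
  -- second loop.
  obtain ⟨f, α, β, hu, hv⟩ := exists_potential (fun v => z (.horizontal v.1 v.2))
    (fun v => -((ε : ℤ) : ZMod D) * z (.vertical v.1 v.2)) (fun x y => by
      have := hz _ ⟨Pi.single (x, y) 1, rfl⟩
      rw [dotProduct_starHom_single] at this
      linear_combination this) x₀ y₀
  refine ⟨_, ⟨f, rfl⟩, ![α, -((ε : ℤ) : ZMod D) * β], ?_⟩
  ext (⟨x, y⟩ | ⟨x, y⟩)
  · simpa [plaquetteHom, loopZ, Fin.sum_univ_two] using hu x y
  · simp only [plaquetteHom, loopZ, Fin.sum_univ_two, AddMonoidHom.coe_mk, ZeroHom.coe_mk,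
      Pi.add_apply, Pi.smul_apply, Matrix.cons_val_zero, Matrix.cons_val_one, smul_eq_mul]
    linear_combination -((ε : ℤ) : ZMod D) * hv x y -
      z (.vertical x y) * units_mul_self (D := D) ε

theorem exists_eq_add_loopX (z : Edge a b → ZMod D)
    (hz : ∀ x ∈ (plaquetteHom ε : (ZMod a × ZMod b → ZMod D) →+ _).range, x ⬝ᵥ z = 0) :
    ∃ z₀ ∈ (starHom ε : (ZMod a × ZMod b → ZMod D) →+ _).range, ∃ c : Fin 2 → ZMod D,
      z = z₀ + ∑ i, c i • loopX D x₀ y₀ i := by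
  -- The differences in `starHom` run forward while those in `exists_potential` run backward, so
  -- both coordinates are reflected. Vertical edges now take the role of `u` and horizontal ones
  -- that of `v`, as on the dual lattice.
  obtain ⟨f, α, β, hu, hv⟩ := exists_potential
    (fun v => ((ε : ℤ) : ZMod D) * z (.vertical (-v.1) (-v.2)))
    (fun v => z (.horizontal (-v.1) (-v.2))) (fun x y => by
      have := hz _ ⟨Pi.single (-x, -y) 1, rfl⟩
      rw [dotProduct_comm, dotProduct_plaquetteHom_single] at this
      have h1 : -(x - 1) = -x + 1 := by ring
      have h2 : -(y - 1) = -y + 1 := by ring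
      simp only [h1, h2]
      linear_combination -this) (-x₀) (-y₀)
  refine ⟨_, ⟨fun v => f (-v.1, -v.2), rfl⟩, ![β, ((ε : ℤ) : ZMod D) * α], ?_⟩
  ext (⟨x, y⟩ | ⟨x, y⟩)
  · have h1 : -(x + 1) = -x - 1 := by ring
    have := hv (-x) (-y)
    simp only [neg_neg, neg_inj] at this
    simp only [starHom, loopX, Fin.sum_univ_two, AddMonoidHom.coe_mk, ZeroHom.coe_mk,
      Pi.add_apply, Pi.smul_apply, Matrix.cons_val_zero, Matrix.cons_val_one, smul_eq_mul, h1]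
    linear_combination this
  · have h1 : -(y + 1) = -y - 1 := by ring
    have := hu (-x) (-y)
    simp only [neg_neg, neg_inj] at this
    simp only [starHom, loopX, Fin.sum_univ_two, AddMonoidHom.coe_mk, ZeroHom.coe_mk,
      Pi.add_apply, Pi.smul_apply, Matrix.cons_val_zero, Matrix.cons_val_one, smul_eq_mul, h1]
    linear_combination ((ε : ℤ) : ZMod D) * this - z (.vertical x y) * units_mul_self (D := D) ε

end Lattice

end Parafermion

/-! ### From generators to normalized words -/

namespace WeylSystem

set_option linter.unusedSectionVars false

variable {G : Type*} [Group G] {D : ℕ} [NeZero D]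

theorem map_mem_of_mem_range {V ι : Type*} [Fintype V] [DecidableEq V]
    (Φ : Multiplicative (ι → ZMod D) →* G) (d : (V → ZMod D) →+ (ι → ZMod D)) {H : Subgroup G}
    (hH : ∀ v, Φ (.ofAdd (d (Pi.single v 1))) ∈ H) : ∀ x ∈ d.range, Φ (.ofAdd x) ∈ H := by
  rintro _ ⟨f, rfl⟩
  induction f using pi_zmod_induction with
  | zero => simp
  | add f g hf hg => rw [map_add, ofAdd_add, map_mul]; exact mul_mem hf hg
  | single v => exact hH v

/-- Central factors cancel in a product with total exponent zero. -/
theorem central_factors_cancel {c : G} (hc : ∀ g, Commute c g) (A B C E : G) (k : ℤ) :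
    c * A * (c * B)⁻¹ * (c * C) ^ k * (c * E) ^ (-k) = A * B⁻¹ * C ^ k * E ^ (-k) := by
  have key : ∀ {d : G}, (∀ g, Commute d g) → ∀ U V : G, d * U * (d * V)⁻¹ = U * V⁻¹ := by
    intro d hd U V
    rw [mul_inv_rev, mul_assoc, ← mul_assoc U, (hd (U * V⁻¹)).inv_left.symm.eq,
      mul_inv_cancel_left]
  rw [key hc, zpow_neg, mul_assoc, (hc C).mul_zpow, (hc E).mul_zpow,
    key fun g => (hc g).zpow_left k, zpow_neg, mul_assoc _ (C ^ k)]

namespace SiteSystem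

variable {ι : Type*} [Fintype ι] [DecidableEq ι]
  {ω η : G} {Γ : Subgroup G} {E X Z Q : ι → G} (h : SiteSystem D ω η Γ E X Z Q)
include h

theorem pow_mul_prod_ofFn_X {k : ℕ} (g : Fin k → ι) :
    η ^ k * (List.ofFn fun i => X (g i)).prod =
      h.homX (.ofAdd (∑ i, Pi.single (g i) 1)) := by
  induction k with
  | zero => simp
  | succ k ih =>
    rw [Fin.sum_univ_succ, ofAdd_add, map_mul, h.homX_single, ← ih fun i => g i.succ,
      List.ofFn_succ, List.prod_cons, pow_succ', mul_assoc, mul_assoc, ← mul_assoc _ (X (g 0)),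
      ((h.η_comm (X (g 0))).pow_left k).eq, mul_assoc]

theorem pow_mul_prod_ofFn_Z {k : ℕ} (g : Fin k → ι) :
    η ^ k * (List.ofFn fun i => Z (g i)).prod =
      h.homZ (.ofAdd (∑ i, Pi.single (g i) 1)) := by
  induction k with
  | zero => simp
  | succ k ih =>
    rw [Fin.sum_univ_succ, ofAdd_add, map_mul, h.homZ_single, ← ih fun i => g i.succ,
      List.ofFn_succ, List.prod_cons, pow_succ', mul_assoc, mul_assoc, ← mul_assoc _ (Z (g 0)),
      ((h.η_comm (Z (g 0))).pow_left k).eq, mul_assoc]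

theorem homQ_mem {H : Subgroup G} (hQ : ∀ i, Q i ∈ H) (w : ι → ZMod D) :
    h.homQ (.ofAdd w) ∈ H :=
  map_mem_of_mem_range h.homQ (AddMonoidHom.id _) (fun i => by
    rw [AddMonoidHom.id_apply, h.homQ_single]; exact hQ i) w ⟨w, rfl⟩

end SiteSystem

end WeylSystem

/-! ### The two codes as word groups -/

namespace Parafermion

open WeylSystem

set_option linter.unusedSectionVars false

variable {D q : ℕ} [NeZero D]

/-- The elements of the parafermion group that commute with the total charge operator. -/
noncomputable def evenGroup (D n : ℕ) [NeZero D] : Subgroup (Op D n) :=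
  PF D n ⊓ Subgroup.centralizer {shift 1}

theorem mem_evenGroup {n : ℕ} {W : Op D n} :
    W ∈ evenGroup D n ↔ W ∈ PF D n ∧ Commute W (shift 1) := by
  rw [evenGroup, Subgroup.mem_inf, Subgroup.mem_centralizer_singleton_iff]
  rfl

theorem preservesParity_of_mem {n : ℕ} {W : Op D n} (hW : W ∈ evenGroup D n) :
    PreservesParity W :=
  hasParity_of_mem (mem_evenGroup.1 hW).1
    (isPhase_omega.weylComm_of_commute (mem_evenGroup.1 hW).2)

theorem isStabilizer_of_le {n : ℕ} {ι : Type*} [Fintype ι] [DecidableEq ι] {η : Op D n}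
    {E X Z Q : ι → Op D n} (h : SiteSystem D (omega D n) η (PF D n) E X Z Q)
    {LX LZ LQ : AddSubgroup (ι → ZMod D)} {ho : ∀ x ∈ LX, ∀ z ∈ LZ, z ⬝ᵥ x = 0}
    (hle : h.wordGroup LX LZ LQ ho ≤ evenGroup D n) : IsStabilizer (h.wordGroup LX LZ LQ ho) :=
  isStabilizer_wordGroup h (fun _ hW => (mem_evenGroup.1 (hle hW)).1)
    fun _ hW => (mem_evenGroup.1 (hle hW)).2

theorem siteQ_mem_evenGroup {m : ℕ} (j : Fin m) : siteQ D q j ∈ evenGroup D (2 * m) :=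
  mem_evenGroup.2 ⟨siteQ_mem j, commute_siteQ_charge j⟩

/-! ### Four modes for each qudit -/

/-- The case `LX = LZ = ⊥`: each complement is the whole space, with the unit vectors as dual bases.
-/
theorem encodesQudits_sites (hq : 0 < q) (hq2 : (q : ZMod D) ^ 2 = 0) (hD : 1 < D) {m : ℕ}
    (hm : 0 < m) :
    EncodesQudits (Subgroup.closure (Set.range (siteQ D q (m := m)))) m (siteX D q)
      (siteZ D q) := by
  have h := siteSystem hq hq2 m
  have ho : ∀ x ∈ (⊥ : AddSubgroup (Fin m → ZMod D)),
      ∀ z ∈ (⊥ : AddSubgroup (Fin m → ZMod D)), z ⬝ᵥ x = 0 := by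
    rintro x - z hz
    rw [AddSubgroup.mem_bot.1 hz, zero_dotProduct]
  have hbot : ∀ {H : Subgroup (Op D (2 * m))} (Φ : Multiplicative (Fin m → ZMod D) →* Op D (2 * m)),
      ∀ x ∈ (⊥ : AddSubgroup (Fin m → ZMod D)), Φ (.ofAdd x) ∈ H := by
    intro H Φ x hx
    rw [AddSubgroup.mem_bot.1 hx, ofAdd_zero, map_one]
    exact one_mem _
  have hS : Subgroup.closure (Set.range (siteQ D q (m := m))) = h.wordGroup ⊥ ⊥ ⊤ ho := by
    apply le_antisymm
    · rw [Subgroup.closure_le]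
      rintro _ ⟨j, rfl⟩
      have := h.homQ_mem_wordGroup (ho := ho) (AddSubgroup.mem_top (Pi.single j 1))
      rwa [h.homQ_single] at this
    · exact h.wordGroup_le (hbot _) (hbot _) fun w _ =>
        h.homQ_mem (fun j => Subgroup.subset_closure (Set.mem_range_self j)) w
  have hle : h.wordGroup ⊥ ⊥ ⊤ ho ≤ evenGroup D (2 * m) :=
    h.wordGroup_le (hbot _) (hbot _) fun w _ => h.homQ_mem siteQ_mem_evenGroup w
  have hspan : ∀ x : Fin m → ZMod D, ∃ x₀ ∈ (⊥ : AddSubgroup (Fin m → ZMod D)),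
      ∃ c : Fin m → ZMod D, x = x₀ + ∑ i, c i • Pi.single i 1 := fun x => by
    refine ⟨0, zero_mem _, x, ?_⟩
    rw [zero_add, ← pi_eq_sum_univ' x]
  rw [hS]
  refine encodesQudits_wordGroup h rfl hD (isStabilizer_of_le h hle) hm ?_ siteX_mem siteZ_mem
    (ξ := fun i => Pi.single i 1) (ζ := fun i => Pi.single i 1) (r := 1) (s := 1)
    (fun i => ?_) (fun i => ?_) (fun i z hz => ?_) (fun i x hx => ?_) (fun i j => ?_)
    (fun x _ => hspan x) (fun z _ => hspan z)
  · rw [AddSubgroup.card_bot, Fintype.card_fin, one_mul, one_mul, ← pow_add, two_mul]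
  · rw [Pi.one_apply, pow_one, h.homX_single]
  · rw [Pi.one_apply, pow_one, h.homZ_single]
  · rw [AddSubgroup.mem_bot.1 hz, zero_dotProduct]
  · rw [AddSubgroup.mem_bot.1 hx, dotProduct_zero]
  · rw [dotProduct_single, mul_one, Pi.single_apply]
    simp only [eq_comm]

/-! ### The toric code -/

section Toric

variable {a b : ℕ} [NeZero a] [NeZero b] (hq : 0 < q) (hq2 : (q : ZMod D) ^ 2 = 0)
  (e : Numbering a b) (ε : ℤˣ)

include hq hq2 in
theorem torusSystem : SiteSystem D (omega D (2 * (2 * (a * b))))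
    (halfPhase D (2 * (2 * (a * b))) ^ (q - 1)) (PF D (2 * (2 * (a * b))))
    (fun s => gamma D (2 * (2 * (a * b))) (mode (e s) 0)) (fun s => siteX D q (e s))
    (fun s => siteZ D q (e s)) (fun s => siteQ D q (e s)) :=
  (siteSystem hq hq2 (2 * (a * b))).reindex e

/-- The four exponents sum to zero, so the factors `η` cancel and the star is a normalized word
without any phase correction. -/
theorem star_eq (v : ZMod a × ZMod b) : star D q e ε v =
    (torusSystem hq hq2 e).homX (.ofAdd (starHom ε (Pi.single v 1))) := by
  have h := torusSystem hq hq2 e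
  rw [starHom_single]
  simp only [ofAdd_add, ofAdd_neg, ofAdd_zsmul, map_mul, map_inv, map_zpow]
  rw [h.homX_single, h.homX_single, h.homX_single, h.homX_single,
    central_factors_cancel h.η_comm]
  rfl

theorem plaquette_eq (v : ZMod a × ZMod b) : plaquette D q e ε v =
    (torusSystem hq hq2 e).homZ (.ofAdd (plaquetteHom ε (Pi.single v 1))) := by
  have h := torusSystem hq hq2 e
  rw [plaquetteHom_single]
  simp only [ofAdd_add, ofAdd_neg, ofAdd_zsmul, map_mul, map_inv, map_zpow]
  rw [h.homZ_single, h.homZ_single, h.homZ_single, h.homZ_single,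
    central_factors_cancel h.η_comm]
  rfl

theorem star_mem_evenGroup (hq : 0 < q) (v : ZMod a × ZMod b) :
    star D q e ε v ∈ evenGroup D (2 * (2 * (a * b))) := by
  have hω := isPhase_omega (D := D) (n := 2 * (2 * (a * b)))
  refine mem_evenGroup.2 ⟨mul_mem (mul_mem (mul_mem (siteX_mem _) (inv_mem (siteX_mem _)))
    (zpow_mem (siteX_mem _) _)) (zpow_mem (siteX_mem _) _), ?_⟩
  have hc := fun s => weylComm_siteX_charge (D := D) hq (e s)
  have := hω.weylComm_mul_left (hω.weylComm_mul_left (hω.weylComm_mul_left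
    (hc (.horizontal v.1 v.2)) (hω.weylComm_inv_left (hc (.horizontal (v.1 - 1) v.2))))
    (hω.weylComm_zpow_left (hc (.vertical v.1 v.2)) ε))
    (hω.weylComm_zpow_left (hc (.vertical v.1 (v.2 - 1))) (-ε))
  rw [add_neg_cancel, zero_add, Int.cast_neg, neg_mul, add_neg_cancel, hω.weylComm_zero_iff] at this
  exact this

theorem plaquette_mem_evenGroup (hq : 0 < q) (v : ZMod a × ZMod b) :
    plaquette D q e ε v ∈ evenGroup D (2 * (2 * (a * b))) := by
  have hω := isPhase_omega (D := D) (n := 2 * (2 * (a * b)))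
  refine mem_evenGroup.2 ⟨mul_mem (mul_mem (mul_mem (siteZ_mem _) (inv_mem (siteZ_mem _)))
    (zpow_mem (siteZ_mem _) _)) (zpow_mem (siteZ_mem _) _), ?_⟩
  have hc := fun s => weylComm_siteZ_charge (D := D) hq (e s)
  have := hω.weylComm_mul_left (hω.weylComm_mul_left (hω.weylComm_mul_left
    (hc (.horizontal v.1 v.2)) (hω.weylComm_inv_left (hc (.horizontal v.1 (v.2 + 1)))))
    (hω.weylComm_zpow_left (hc (.vertical (v.1 + 1) v.2)) ε))
    (hω.weylComm_zpow_left (hc (.vertical v.1 v.2)) (-ε))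
  rw [add_neg_cancel, zero_add, Int.cast_neg, neg_mul, add_neg_cancel, hω.weylComm_zero_iff] at this
  exact this

/-- The words of star operators, plaquette operators, and the `Q̃^w` with `w ∈ LQ`. -/
noncomputable def torusWords (LQ : AddSubgroup (Edge a b → ZMod D)) :
    Subgroup (Op D (2 * (2 * (a * b)))) :=
  (torusSystem hq hq2 e).wordGroup (starHom ε).range (plaquetteHom ε).range LQ
    (plaquette_star_orthogonal ε)

theorem torusWords_le {LQ : AddSubgroup (Edge a b → ZMod D)}
    {H : Subgroup (Op D (2 * (2 * (a * b))))} (hA : ∀ v, star D q e ε v ∈ H)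
    (hB : ∀ v, plaquette D q e ε v ∈ H)
    (hQ : ∀ w ∈ LQ, (torusSystem hq hq2 e).homQ (.ofAdd w) ∈ H) :
    torusWords hq hq2 e ε LQ ≤ H :=
  (torusSystem hq hq2 e).wordGroup_le
    (map_mem_of_mem_range _ _ fun v => star_eq hq hq2 e ε v ▸ hA v)
    (map_mem_of_mem_range _ _ fun v => plaquette_eq hq hq2 e ε v ▸ hB v) hQ

theorem star_mem_torusWords (LQ : AddSubgroup (Edge a b → ZMod D)) (v : ZMod a × ZMod b) :
    star D q e ε v ∈ torusWords hq hq2 e ε LQ := by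
  rw [star_eq hq hq2]
  exact (torusSystem hq hq2 e).homX_mem_wordGroup ⟨_, rfl⟩

theorem plaquette_mem_torusWords (LQ : AddSubgroup (Edge a b → ZMod D)) (v : ZMod a × ZMod b) :
    plaquette D q e ε v ∈ torusWords hq hq2 e ε LQ := by
  rw [plaquette_eq hq hq2]
  exact (torusSystem hq hq2 e).homZ_mem_wordGroup ⟨_, rfl⟩

theorem starPlaquetteGroup_eq :
    starPlaquetteGroup D q e ε = torusWords hq hq2 e ε ⊥ := by
  apply le_antisymm
  · rw [starPlaquetteGroup, Subgroup.closure_le]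
    rintro _ (⟨v, rfl⟩ | ⟨v, rfl⟩)
    · exact star_mem_torusWords hq hq2 e ε ⊥ v
    · exact plaquette_mem_torusWords hq hq2 e ε ⊥ v
  · refine torusWords_le hq hq2 e ε (fun v => Subgroup.subset_closure (.inl ⟨v, rfl⟩))
      (fun v => Subgroup.subset_closure (.inr ⟨v, rfl⟩)) fun w hw => ?_
    rw [AddSubgroup.mem_bot.1 hw, ofAdd_zero, map_one]
    exact one_mem _

theorem toricGroup_eq : toricGroup D q e ε = torusWords hq hq2 e ε ⊤ := by
  apply le_antisymm
  · refine sup_le ?_ ?_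
    · rw [starPlaquetteGroup, Subgroup.closure_le]
      rintro _ (⟨v, rfl⟩ | ⟨v, rfl⟩)
      · exact star_mem_torusWords hq hq2 e ε ⊤ v
      · exact plaquette_mem_torusWords hq hq2 e ε ⊤ v
    · rw [Subgroup.closure_le]
      rintro _ ⟨j, rfl⟩
      obtain ⟨s, rfl⟩ := e.surjective j
      rw [← (torusSystem hq hq2 e).homQ_single s]
      exact (torusSystem hq hq2 e).homQ_mem_wordGroup (AddSubgroup.mem_top _)
  · refine torusWords_le hq hq2 e ε
      (fun v => Subgroup.mem_sup_left (Subgroup.subset_closure (.inl (Set.mem_range_self v))))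
      (fun v => Subgroup.mem_sup_left (Subgroup.subset_closure (.inr (Set.mem_range_self v)))) fun w _ => ?_
    exact (torusSystem hq hq2 e).homQ_mem
      (fun s => Subgroup.mem_sup_right (Subgroup.subset_closure (Set.mem_range_self (e s)))) w

theorem torusWords_le_evenGroup (LQ : AddSubgroup (Edge a b → ZMod D)) :
    torusWords hq hq2 e ε LQ ≤ evenGroup D (2 * (2 * (a * b))) :=
  torusWords_le hq hq2 e ε (star_mem_evenGroup e ε hq) (plaquette_mem_evenGroup e ε hq)
    fun w _ => (torusSystem hq hq2 e).homQ_mem (fun s => siteQ_mem_evenGroup (e s)) w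

theorem isStabilizer_torusWords (LQ : AddSubgroup (Edge a b → ZMod D)) :
    IsStabilizer (torusWords hq hq2 e ε LQ) :=
  isStabilizer_of_le _ (torusWords_le_evenGroup hq hq2 e ε LQ)

theorem card_torusWords (LQ : AddSubgroup (Edge a b → ZMod D)) :
    Nat.card (torusWords hq hq2 e ε LQ) = D ^ (2 * (a * b - 1)) * Nat.card LQ := by
  rw [torusWords, SiteSystem.card_wordGroup, card_range_starHom, card_range_plaquetteHom,
    ← mul_assoc, ← pow_add, two_mul]

include hq hq2 in
theorem card_starPlaquetteGroup :
    Nat.card (starPlaquetteGroup D q e ε) = D ^ (2 * (a * b - 1)) := by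
  rw [starPlaquetteGroup_eq hq hq2, card_torusWords, AddSubgroup.card_bot, mul_one]

include hq hq2 in
theorem card_toricGroup :
    Nat.card (toricGroup D q e ε) = D ^ (2 * (a * b) + 2 * (a * b - 1)) := by
  rw [toricGroup_eq hq hq2, card_torusWords, AddSubgroup.card_top, Nat.card_fun, Nat.card_zmod,
    Nat.card_eq_fintype_card, card_edge, ← pow_add, add_comm]

include hq hq2 in
-- The product over all vertices, in any order, is the word of `starHom` at the constant function
-- `1`, which lies in the kernel.
theorem prod_star_eq_one (f : Fin (a * b) ≃ ZMod a × ZMod b) :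
    (List.ofFn fun i => star D q e ε (f i)).prod = 1 := by
  have h1 : (List.ofFn fun i => star D q e ε (f i)) =
      (List.ofFn fun i => Multiplicative.ofAdd
        (starHom (D := D) ε (Pi.single (f i) 1))).map (torusSystem hq hq2 e).homX := by
    rw [List.map_ofFn]
    congr 1
    funext i
    exact star_eq hq hq2 e ε (f i)
  rw [h1, List.prod_hom, List.prod_ofFn, ← ofAdd_sum, ← map_sum,
    Equiv.sum_comp f fun v => (Pi.single v 1 : ZMod a × ZMod b → ZMod D)]
  have h2 : starHom ε (∑ v, (Pi.single v 1 : ZMod a × ZMod b → ZMod D)) = 0 :=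
    (starHom_eq_zero_iff ε _).2 ⟨1, by ext w; simp [Finset.sum_apply, Pi.single_apply]⟩
  rw [h2, ofAdd_zero, map_one]

include hq hq2 in
theorem prod_plaquette_eq_one (f : Fin (a * b) ≃ ZMod a × ZMod b) :
    (List.ofFn fun i => plaquette D q e ε (f i)).prod = 1 := by
  have h1 : (List.ofFn fun i => plaquette D q e ε (f i)) =
      (List.ofFn fun i => Multiplicative.ofAdd
        (plaquetteHom (D := D) ε (Pi.single (f i) 1))).map (torusSystem hq hq2 e).homZ := by
    rw [List.map_ofFn]
    congr 1
    funext i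
    exact plaquette_eq hq hq2 e ε (f i)
  rw [h1, List.prod_hom, List.prod_ofFn, ← ofAdd_sum, ← map_sum,
    Equiv.sum_comp f fun v => (Pi.single v 1 : ZMod a × ZMod b → ZMod D)]
  have h2 : plaquetteHom ε (∑ v, (Pi.single v 1 : ZMod a × ZMod b → ZMod D)) = 0 :=
    (plaquetteHom_eq_zero_iff ε _).2 ⟨1, by ext w; simp [Finset.sum_apply, Pi.single_apply]⟩
  rw [h2, ofAdd_zero, map_one]

/-! ### Loop operators -/

theorem prod_ofFn_siteX_mem {k m : ℕ} (g : Fin k → Fin m) :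
    (List.ofFn fun i => siteX D q (g i)).prod ∈ PF D (2 * m) := by
  refine list_prod_mem fun W hW => ?_
  obtain ⟨i, rfl⟩ := (List.mem_ofFn' _ _).1 hW
  exact siteX_mem _

theorem prod_ofFn_siteZ_mem {k m : ℕ} (g : Fin k → Fin m) :
    (List.ofFn fun i => siteZ D q (g i)).prod ∈ PF D (2 * m) := by
  refine list_prod_mem fun W hW => ?_
  obtain ⟨i, rfl⟩ := (List.mem_ofFn' _ _).1 hW
  exact siteZ_mem _

theorem hasParity_prod_ofFn {k n : ℕ} (W : Fin k → Op D n)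
    (hW : ∀ i, WeylComm (omega D n) (W i) (shift 1) (q : ZMod D))
    (hPF : (List.ofFn W).prod ∈ PF D n) :
    HasParity (List.ofFn W).prod ((k * q : ℕ) : ZMod D) := by
  refine hasParity_of_mem hPF ?_
  have := isPhase_omega.weylComm_list_prod (List.finRange k) W (fun _ => (q : ZMod D)) hW
  rw [List.ofFn_eq_map]
  simpa using this

theorem hasParity_prod_ofFn_siteX (hq : 0 < q) {k m : ℕ} (g : Fin k → Fin m) :
    HasParity (List.ofFn fun i => siteX D q (g i)).prod ((k * q : ℕ) : ZMod D) :=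
  hasParity_prod_ofFn _ (fun i => weylComm_siteX_charge hq (g i)) (prod_ofFn_siteX_mem g)

theorem hasParity_prod_ofFn_siteZ (hq : 0 < q) {k m : ℕ} (g : Fin k → Fin m) :
    HasParity (List.ofFn fun i => siteZ D q (g i)).prod ((k * q : ℕ) : ZMod D) :=
  hasParity_prod_ofFn _ (fun i => weylComm_siteZ_charge hq (g i)) (prod_ofFn_siteZ_mem g)

/-- The charge is unique, and `q * q ∣ k * q` means `q ∣ k`. -/
theorem preservesParity_iff (hq : 0 < q) (hD : D = q * q) {n k : ℕ} {W : Op D n}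
    (hW : HasParity W ((k * q : ℕ) : ZMod D)) : PreservesParity W ↔ q ∣ k := by
  have h1 : ((k * q : ℕ) : ZMod D) = 0 ↔ q ∣ k := by
    rw [ZMod.natCast_eq_zero_iff]
    conv_lhs => rw [hD]
    exact Nat.mul_dvd_mul_iff_right hq
  rw [← h1]
  refine ⟨fun h => hW.unique h, fun h => ?_⟩
  rw [h] at hW
  exact hW

theorem sum_single_horizontal_column (x : ZMod a) (y : ZMod b) :
    ∑ i : Fin b, (Pi.single (Edge.horizontal x ((i : ℕ) : ZMod b)) 1 : Edge a b → ZMod D) =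
      loopX D x y 0 := by
  rw [sum_zmod_eq_sum_fin (fun y' : ZMod b => (Pi.single (Edge.horizontal x y') 1 : Edge a b → ZMod D))]
  ext (⟨x', y'⟩ | ⟨x', y'⟩) <;> simp [Finset.sum_apply, Pi.single_apply, loopX, ite_and]

theorem sum_single_vertical_row (x : ZMod a) (y : ZMod b) :
    ∑ i : Fin a, (Pi.single (Edge.vertical ((i : ℕ) : ZMod a) y) 1 : Edge a b → ZMod D) =
      loopX D x y 1 := by
  rw [sum_zmod_eq_sum_fin (fun x' : ZMod a => (Pi.single (Edge.vertical x' y) 1 : Edge a b → ZMod D))]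
  ext (⟨x', y'⟩ | ⟨x', y'⟩) <;> simp [Finset.sum_apply, Pi.single_apply, loopX, ite_and]

theorem sum_single_horizontal_row (x : ZMod a) (y : ZMod b) :
    ∑ i : Fin a, (Pi.single (Edge.horizontal ((i : ℕ) : ZMod a) y) 1 : Edge a b → ZMod D) =
      loopZ D x y 0 := by
  rw [sum_zmod_eq_sum_fin (fun x' : ZMod a => (Pi.single (Edge.horizontal x' y) 1 : Edge a b → ZMod D))]
  ext (⟨x', y'⟩ | ⟨x', y'⟩) <;> simp [Finset.sum_apply, Pi.single_apply, loopZ, ite_and]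

theorem sum_single_vertical_column (x : ZMod a) (y : ZMod b) :
    ∑ i : Fin b, (Pi.single (Edge.vertical x ((i : ℕ) : ZMod b)) 1 : Edge a b → ZMod D) =
      loopZ D x y 1 := by
  rw [sum_zmod_eq_sum_fin (fun y' : ZMod b => (Pi.single (Edge.vertical x y') 1 : Edge a b → ZMod D))]
  ext (⟨x', y'⟩ | ⟨x', y'⟩) <;> simp [Finset.sum_apply, Pi.single_apply, loopZ, ite_and]

include hq hq2 in
theorem encodesQudits_toric (hD : 1 < D) (x : ZMod a) (y : ZMod b) :
    EncodesQudits (toricGroup D q e ε) 2 ![verticalX D q e x, horizontalX D q e y]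
      ![horizontalZ D q e y, verticalZ D q e x] := by
  have h := torusSystem hq hq2 e
  rw [toricGroup_eq hq hq2]
  refine encodesQudits_wordGroup h rfl hD (isStabilizer_torusWords hq hq2 e ε ⊤) two_pos ?_
    (Fin.forall_fin_two.2 ⟨prod_ofFn_siteX_mem _, prod_ofFn_siteX_mem _⟩)
    (Fin.forall_fin_two.2 ⟨prod_ofFn_siteZ_mem _, prod_ofFn_siteZ_mem _⟩)
    -- The entries of `r` and `s` are the loop lengths, with one factor `η` for each site on the
    -- loop.
    (ξ := loopX D x y) (ζ := loopZ D x y) (r := ![b, a]) (s := ![a, b])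
    (Fin.forall_fin_two.2 ⟨?_, ?_⟩) (Fin.forall_fin_two.2 ⟨?_, ?_⟩)
    (loopX_orthogonal ε x y) (loopZ_orthogonal ε x y) (loopZ_dotProduct_loopX x y)
    (exists_eq_add_loopX ε x y) (exists_eq_add_loopZ ε x y)
  · rw [card_range_starHom, card_range_plaquetteHom, card_edge, ← pow_add, ← pow_add, ← pow_add]
    congr 1
    have : 0 < a * b := Nat.mul_pos (Nat.pos_of_ne_zero (NeZero.ne a))
      (Nat.pos_of_ne_zero (NeZero.ne b))
    omega
  · rw [← sum_single_horizontal_column]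
    exact h.pow_mul_prod_ofFn_X fun i : Fin b => .horizontal x ((i : ℕ) : ZMod b)
  · rw [← sum_single_vertical_row]
    exact h.pow_mul_prod_ofFn_X fun i : Fin a => .vertical ((i : ℕ) : ZMod a) y
  · rw [← sum_single_horizontal_row]
    exact h.pow_mul_prod_ofFn_Z fun i : Fin a => .horizontal ((i : ℕ) : ZMod a) y
  · rw [← sum_single_vertical_column]
    exact h.pow_mul_prod_ofFn_Z fun i : Fin b => .vertical x ((i : ℕ) : ZMod b)

end Toric

end Parafermion

theorem mainTheorem4 (p l D : ℕ) (hp : p.Prime) (hl : 0 < l) [NeZero D] (hD : D = p ^ (2 * l)) :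
    -- the mapping of four modes to one qudit, on `m` sites
    (((p ^ l : ℕ) : ZMod D) ≠ 0 ∧
      ∀ m : ℕ, 0 < m →
        Parafermion.EncodesQudits
            (Subgroup.closure (Set.range (Parafermion.siteQ D (p ^ l) (m := m)))) m
            (Parafermion.siteX D (p ^ l)) (Parafermion.siteZ D (p ^ l)) ∧
        ∀ j : Fin m,
          Parafermion.HasParity (Parafermion.siteX D (p ^ l) j) ((p ^ l : ℕ) : ZMod D) ∧
          Parafermion.HasParity (Parafermion.siteZ D (p ^ l) j) ((p ^ l : ℕ) : ZMod D) ∧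
          Parafermion.PreservesParity (Parafermion.siteQ D (p ^ l) j)) ∧
    -- the toric code
    ∀ (a b : ℕ), 0 < a → 0 < b → ∀ (e : Parafermion.Numbering a b) (ε : ℤˣ),
      -- the star and plaquette operators commute and preserve parity
      (∀ v w, Commute (Parafermion.star D (p ^ l) e ε v) (Parafermion.star D (p ^ l) e ε w) ∧
        Commute (Parafermion.plaquette D (p ^ l) e ε v) (Parafermion.plaquette D (p ^ l) e ε w) ∧
        Commute (Parafermion.star D (p ^ l) e ε v) (Parafermion.plaquette D (p ^ l) e ε w)) ∧
      (∀ v, Parafermion.PreservesParity (Parafermion.star D (p ^ l) e ε v) ∧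
        Parafermion.PreservesParity (Parafermion.plaquette D (p ^ l) e ε v)) ∧
      -- the product over all stars, and that over all plaquettes, is the identity
      (∀ f : Fin (a * b) ≃ ZMod a × ZMod b,
        (List.ofFn fun i => Parafermion.star D (p ^ l) e ε (f i)).prod = 1 ∧
        (List.ofFn fun i => Parafermion.plaquette D (p ^ l) e ε (f i)).prod = 1) ∧
      -- they generate a stabilizer group with `2 (a b - 1)` independent generators
      Parafermion.IsStabilizer (Parafermion.starPlaquetteGroup D (p ^ l) e ε) ∧
      Nat.card (Parafermion.starPlaquetteGroup D (p ^ l) e ε) = D ^ (2 * (a * b - 1)) ∧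
      Nat.card (Parafermion.toricGroup D (p ^ l) e ε) = D ^ (2 * (a * b) + 2 * (a * b - 1)) ∧
      -- the code encodes two qudits, with the loops in any row and column as logical operators
      (∀ (x : ZMod a) (y : ZMod b),
        Parafermion.EncodesQudits (Parafermion.toricGroup D (p ^ l) e ε) 2
          ![Parafermion.verticalX D (p ^ l) e x, Parafermion.horizontalX D (p ^ l) e y]
          ![Parafermion.horizontalZ D (p ^ l) e y, Parafermion.verticalZ D (p ^ l) e x]) ∧
      -- horizontal loops have parity `a p^l`, and preserve parity iff `p^l` divides `a`
      (∀ y : ZMod b, ∀ L ∈ ({Parafermion.horizontalX D (p ^ l) e y,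
          Parafermion.horizontalZ D (p ^ l) e y} : Set _),
        Parafermion.HasParity L ((a * p ^ l : ℕ) : ZMod D) ∧
        (Parafermion.PreservesParity L ↔ p ^ l ∣ a)) ∧
      -- vertical loops have parity `b p^l`, and preserve parity iff `p^l` divides `b`
      (∀ x : ZMod a, ∀ L ∈ ({Parafermion.verticalX D (p ^ l) e x,
          Parafermion.verticalZ D (p ^ l) e x} : Set _),
        Parafermion.HasParity L ((b * p ^ l : ℕ) : ZMod D) ∧
        (Parafermion.PreservesParity L ↔ p ^ l ∣ b)) := by
  have hq : 0 < p ^ l := pow_pos hp.pos l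
  have hDq : D = p ^ l * p ^ l := by rw [hD, two_mul, pow_add]
  have hq1 : 1 < p ^ l := Nat.one_lt_pow hl.ne' hp.one_lt
  have hD1 : 1 < D := by rw [hDq]; exact one_lt_mul'' hq1 hq1
  have hq2 : ((p ^ l : ℕ) : ZMod D) ^ 2 = 0 := by
    rw [sq, ← Nat.cast_mul, ← hDq, ZMod.natCast_self]
  refine ⟨⟨fun h => ?_, fun m hm => ⟨Parafermion.encodesQudits_sites hq hq2 hD1 hm, fun j =>
    ⟨Parafermion.hasParity_of_mem (Parafermion.siteX_mem j)
        (Parafermion.weylComm_siteX_charge hq j),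
      Parafermion.hasParity_of_mem (Parafermion.siteZ_mem j)
        (Parafermion.weylComm_siteZ_charge hq j),
      Parafermion.preservesParity_of_mem (Parafermion.siteQ_mem_evenGroup j)⟩⟩⟩, ?_⟩
  -- The charge `q` is nonzero modulo `D` because `1 < q` gives `q < q * q`.
  · have h1 := Nat.le_of_dvd hq ((ZMod.natCast_eq_zero_iff _ _).1 h)
    rw [hDq] at h1
    nlinarith
  intro a b ha hb e ε
  have : NeZero a := ⟨ha.ne'⟩
  have : NeZero b := ⟨hb.ne'⟩
  have hA := Parafermion.star_mem_torusWords hq hq2 e ε ⊥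
  have hB := Parafermion.plaquette_mem_torusWords hq hq2 e ε ⊥
  have hc := fun {U V} hU hV =>
    (Parafermion.isStabilizer_torusWords hq hq2 e ε ⊥).abelian U hU V hV
  refine ⟨fun v w => ⟨hc (hA v) (hA w), hc (hB v) (hB w), hc (hA v) (hB w)⟩,
    fun v => ⟨Parafermion.preservesParity_of_mem (Parafermion.star_mem_evenGroup e ε hq v),
      Parafermion.preservesParity_of_mem (Parafermion.plaquette_mem_evenGroup e ε hq v)⟩,
    fun f => ⟨Parafermion.prod_star_eq_one hq hq2 e ε f,
      Parafermion.prod_plaquette_eq_one hq hq2 e ε f⟩,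
    ?_, Parafermion.card_starPlaquetteGroup hq hq2 e ε, Parafermion.card_toricGroup hq hq2 e ε,
    Parafermion.encodesQudits_toric hq hq2 e ε hD1, fun y L hL => ?_, fun x L hL => ?_⟩
  · rw [Parafermion.starPlaquetteGroup_eq hq hq2]
    exact Parafermion.isStabilizer_torusWords hq hq2 e ε ⊥
  · have hL' : Parafermion.HasParity L ((a * p ^ l : ℕ) : ZMod D) := by
      rcases hL with rfl | rfl
      · exact Parafermion.hasParity_prod_ofFn_siteX hq _
      · exact Parafermion.hasParity_prod_ofFn_siteZ hq _
    exact ⟨hL', Parafermion.preservesParity_iff hq hDq hL'⟩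
  · have hL' : Parafermion.HasParity L ((b * p ^ l : ℕ) : ZMod D) := by
      rcases hL with rfl | rfl
      · exact Parafermion.hasParity_prod_ofFn_siteX hq _
      · exact Parafermion.hasParity_prod_ofFn_siteZ hq _
    exact ⟨hL', Parafermion.preservesParity_iff hq hDq hL'⟩
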